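/- **Setting.** Let $N\ge 2$, and let $1<p<\frac{N+2}{N-2}$ if $N>2$, $1<p<\infty$ if $N=2$. On the hyperbolic space $\mathbb H^N$ use geodesic polar coordinates $(r,\theta)\in[0,\infty)\times\mathbb S^{N-1}$ around a fixed origin, in which the metric is $dr^2+\sinh^2 r\,d\theta^2$. For $R>0$ let $B_R=\{r<R\}$ and $B_R^c=\mathbb H^N\setminus B_R$. Let $dx$ and $ds_x$ denote the hyperbolic volume and surface measures. Let $G$ be a group of isometries of $\mathbb S^{N-1}$. A function $\psi\in H^1(B_R^c)$ is $G$-symmetric if $\psi(r,g\theta)=\psi(r,\theta)$ a.e. for all $g\in G$; these functions form $H^1_G(B_R^c)$. The eigenvalues of $-\Delta_{\mathbb S^{N-1}}$ are $\mu_i=i(i+N-2)$, $i\ge 0$. **(G1)** There is a least $i\ge 1$, denoted $i_1$, for which $\mu_{i}$ is an eigenvalue of $-\Delta_{\mathbb S^{N-1}}$ restricted to $G$-symmetric functions. The multiplicity of $\mu_{i_1}$ in this restricted problem is odd, and $$i_1>\frac{2-N+\sqrt{(N-2)^2+\frac{16}{9}(N+2)(N-1)}}{2}.$$ **The function $z_R$.**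 Put $\lambda=1/R^2$. Let $u_\lambda$ be the unique positive radial solution of $-\lambda\Delta u+u-u^p=0$ in $B_1^c$ with $u=0$ on $\partial B_1$ and $u\to 0$ at infinity. Let $z_\lambda$ be the positive radial $H^1_0(B_1^c)$-eigenfunction, normalized by $\|z_\lambda\|_{L^2(B_1^c)}=1$, of $-\lambda\Delta+1-p\,u_\lambda^{p-1}$ for its unique negative eigenvalue on radial functions. Write $z_\lambda=z_\lambda(r)$ and set $z_R(r,\theta)=z_\lambda(r/R)$. **Lemma.** Suppose that $G$ satisfies (G1) and let $R>0$. Then $$\frac{1}{\sinh R}\int_{\partial B_R}\psi^2\,ds_x\;\le\;\frac{3}{4(N-1)}\int_{B_R^c}|\nabla\psi|^2\,dx$$ for every $\psi\in H^1_G(B_R^c)$ with $\int_{\partial B_R}\psi\,ds_x=0$ and $\int_{B_R^c}\psi\, z_R\,dx=0$, where the values of $\psi$ on $\partial B_R$ are taken in the sense of traces. -/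

import Mathlib

open MeasureTheory Filter Topology Metric
open scoped ContDiff InnerProductSpace RealInnerProductSpace Laplacian

namespace HypExt

/-! ### Hyperbolic space in geodesic normal coordinates at the origin `O`

The point `exp_O x` of `ℍ^N` is represented by the tangent vector `x ∈ T_O ℍ^N = ℝ^N`, so that
`‖x‖` is the geodesic distance to `O` and `x / ‖x‖` is the angular variable `θ ∈ 𝕊^{N-1}`. -/

/-- The tangent space of `ℍ^N` at the origin, used as a global chart of `ℍ^N` through `exp_O`. -/
abbrev E (N : ℕ) : Type := EuclideanSpace ℝ (Fin N)

/-- The unit sphere `𝕊^{N-1}`. -/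
abbrev Sph (N : ℕ) : Type := sphere (0 : E N) 1

/-- The exponential map at `O = (1, 0)` into the hyperboloid
`{(x₀, x') : x₀ ^ 2 - |x'| ^ 2 = 1, x₀ > 0}`: `r θ ↦ (cosh r, sinh r θ)`. -/
noncomputable def expO {N : ℕ} (x : E N) : ℝ × E N :=
  (Real.cosh ‖x‖, (Real.sinh ‖x‖ / ‖x‖) • x)

/-- The hyperbolic metric `dr² + sinh² r dω²` in the exponential chart at a point `x ≠ 0`. -/
noncomputable def hypMetric {N : ℕ} (x v w : E N) : ℝ :=
  (⟪x, v⟫_ℝ / ‖x‖) * (⟪x, w⟫_ℝ / ‖x‖)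
    + (Real.sinh ‖x‖ / ‖x‖) ^ 2 * (⟪v, w⟫_ℝ - (⟪x, v⟫_ℝ / ‖x‖) * (⟪x, w⟫_ℝ / ‖x‖))

/-- The point `expO x` lies on the hyperboloid. -/
lemma expO_mem {N : ℕ} (x : E N) : (expO x).1 ^ 2 - ‖(expO x).2‖ ^ 2 = 1 ∧ 0 < (expO x).1 := by
  refine ⟨?_, Real.cosh_pos _⟩
  by_cases hx : x = 0
  · simp [expO, hx]
  · have h : ‖x‖ ≠ 0 := norm_ne_zero_iff.2 hx
    simp only [expO, norm_smul, norm_div, mul_pow, div_pow, Real.norm_eq_abs, sq_abs]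
    field_simp
    exact Real.cosh_sq_sub_sinh_sq _

/-- The derivative of `expO` away from the origin. -/
lemma hasFDerivAt_expO {N : ℕ} {x : E N} (hx : x ≠ 0) :
    HasFDerivAt expO
      (((Real.sinh ‖x‖) • (‖x‖⁻¹ • innerSL ℝ x)).prod
        ((Real.sinh ‖x‖ / ‖x‖) • ContinuousLinearMap.id ℝ (E N)
          + (((Real.cosh ‖x‖ * ‖x‖ - Real.sinh ‖x‖) / ‖x‖ ^ 2) • (‖x‖⁻¹ • innerSL ℝ x)).smulRight x))
      x := by
  have h : ‖x‖ ≠ 0 := norm_ne_zero_iff.2 hx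
  have hn : HasFDerivAt (fun y : E N => ‖y‖) (‖x‖⁻¹ • innerSL ℝ x) x := by
    have h1 := (hasStrictFDerivAt_norm_sq x).hasFDerivAt.sqrt (by positivity)
    have h2 : (fun y : E N => √(‖y‖ ^ 2)) = fun y => ‖y‖ := by
      funext y; exact Real.sqrt_sq (norm_nonneg y)
    rw [h2, Real.sqrt_sq (norm_nonneg x)] at h1
    refine h1.congr_fderiv ?_
    ext v
    simp only [_root_.smul_apply, innerSL_apply_apply, smul_eq_mul, nsmul_eq_mul]
    push_cast
    field_simp
  refine HasFDerivAt.prodMk ?_ ?_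
  · exact (Real.hasDerivAt_cosh ‖x‖).comp_hasFDerivAt x hn
  · have hq : HasDerivAt (fun r : ℝ => Real.sinh r / r)
        ((Real.cosh ‖x‖ * ‖x‖ - Real.sinh ‖x‖) / ‖x‖ ^ 2) ‖x‖ := by
      refine HasDerivAt.congr_deriv
        (HasDerivAt.fun_div (Real.hasDerivAt_sinh ‖x‖) (hasDerivAt_id' ‖x‖) h) ?_
      rw [mul_one]
    exact (hq.comp_hasFDerivAt x hn).smul (hasFDerivAt_id x)

/-- `hypMetric` is the metric induced on the hyperboloid by `-dx₀² + (dx')²`, read through the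
exponential map. -/
lemma hypMetric_eq_lorentz {N : ℕ} {x : E N} (hx : x ≠ 0) (v w : E N) :
    hypMetric x v w =
      -((fderiv ℝ expO x v).1 * (fderiv ℝ expO x w).1)
        + ⟪(fderiv ℝ expO x v).2, (fderiv ℝ expO x w).2⟫_ℝ := by
  have h : ‖x‖ ≠ 0 := norm_ne_zero_iff.2 hx
  rw [(hasFDerivAt_expO hx).fderiv]
  simp only [hypMetric, ContinuousLinearMap.prod_apply, _root_.smul_apply,
    innerSL_apply_apply, _root_.add_apply, ContinuousLinearMap.id_apply,
    ContinuousLinearMap.smulRight_apply, inner_add_left, inner_add_right, real_inner_smul_left,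
    real_inner_smul_right, smul_eq_mul, real_inner_self_eq_norm_sq]
  rw [real_inner_comm x v]
  have hc : Real.cosh ‖x‖ ^ 2 = 1 + Real.sinh ‖x‖ ^ 2 := by
    have := Real.cosh_sq_sub_sinh_sq ‖x‖; linarith
  field_simp
  ring_nf
  rw [hc]
  ring

/-- The Riemannian gradient at `x ≠ 0` of a function whose differential at `x` (in the chart) is
`v ↦ ⟪ξ, v⟫`. -/
noncomputable def hypGrad {N : ℕ} (x ξ : E N) : E N :=
  (⟪x, ξ⟫_ℝ / ‖x‖ ^ 2) • x
    + (‖x‖ / Real.sinh ‖x‖) ^ 2 • (ξ - (⟪x, ξ⟫_ℝ / ‖x‖ ^ 2) • x)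

/-- `|∇ψ|²` in the hyperbolic metric, for a differential `v ↦ ⟪ξ, v⟫` at `x`. -/
noncomputable def gradSq {N : ℕ} (x ξ : E N) : ℝ := hypMetric x (hypGrad x ξ) (hypGrad x ξ)

/-- The defining property of the gradient. -/
lemma hypMetric_hypGrad {N : ℕ} {x : E N} (hx : x ≠ 0) (ξ v : E N) :
    hypMetric x (hypGrad x ξ) v = ⟪ξ, v⟫_ℝ := by
  have h : ‖x‖ ≠ 0 := norm_ne_zero_iff.2 hx
  have hs : Real.sinh ‖x‖ ≠ 0 := (Real.sinh_pos_iff.2 (norm_pos_iff.2 hx)).ne'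
  simp only [hypMetric, hypGrad, inner_add_left, inner_add_right, inner_smul_left,
    inner_smul_right, inner_sub_left, inner_sub_right, real_inner_self_eq_norm_sq]
  simp
  field_simp
  ring

/-- `|∇ψ|² = (∂_r ψ)² + sinh⁻² r |∇_θ ψ|²` in the exponential chart. -/
lemma gradSq_eq {N : ℕ} {x : E N} (hx : x ≠ 0) (ξ : E N) :
    gradSq x ξ = (⟪x, ξ⟫_ℝ / ‖x‖) ^ 2
      + (‖x‖ / Real.sinh ‖x‖) ^ 2 * (‖ξ‖ ^ 2 - (⟪x, ξ⟫_ℝ / ‖x‖) ^ 2) := by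
  have h : ‖x‖ ≠ 0 := norm_ne_zero_iff.2 hx
  rw [gradSq, hypMetric_hypGrad hx]
  simp only [hypGrad, inner_add_right, inner_smul_right, inner_sub_right,
    real_inner_self_eq_norm_sq, real_inner_comm x ξ]
  field_simp

/-- The Riemannian volume `sinh^{N-1} r dr dθ`; in the exponential chart its density with respect
to Lebesgue measure `r^{N-1} dr dθ` is `(sinh r / r)^{N-1}`. -/
noncomputable def hypVol (N : ℕ) : Measure (E N) :=
  (volume : Measure (E N)).withDensity
    fun x => ENNReal.ofReal ((Real.sinh ‖x‖ / ‖x‖) ^ (N - 1))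

/-- `B_R^c`, up to its boundary sphere (a null set): the points at distance `> R` from `O`. -/
def extBall (N : ℕ) (R : ℝ) : Set (E N) := {x | R < ‖x‖}

/-- The surface measure of `𝕊^{N-1}`. -/
noncomputable def sphMeas (N : ℕ) : Measure (Sph N) := (volume : Measure (E N)).toSphere

/-- The surface measure of the geodesic sphere `∂B_R`, parametrized by `θ ↦ exp_O (R θ)`. -/
noncomputable def bdryMeas (N : ℕ) (R : ℝ) : Measure (Sph N) :=
  ENNReal.ofReal (Real.sinh R ^ (N - 1)) • sphMeas N

/-! ### The Sobolev space `H¹(B_R^c)`, boundary traces, symmetry -/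

/-- `ψ ∈ H¹(B_R^c)` and its weak differential is `v ↦ ⟪Ψ x, v⟫`. Weak differentials do not depend
on the metric, so they are tested in the chart with Lebesgue measure; the `L²` conditions are those
of the hyperbolic metric. -/
structure MemH1 {N : ℕ} (R : ℝ) (ψ : E N → ℝ) (Ψ : E N → E N) : Prop where
  memLp : MemLp ψ 2 ((hypVol N).restrict (extBall N R))
  aesm_grad : AEStronglyMeasurable Ψ ((hypVol N).restrict (extBall N R))
  integrable_grad : Integrable (fun x => gradSq x (Ψ x)) ((hypVol N).restrict (extBall N R))
  weak : ∀ φ : E N → ℝ, ContDiff ℝ ∞ φ → HasCompactSupport φ → tsupport φ ⊆ extBall N R →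
    ∀ v : E N, ∫ x in extBall N R, ψ x * fderiv ℝ φ x v = -∫ x in extBall N R, ⟪Ψ x, v⟫_ℝ * φ x

/-- `t` is the boundary trace of `ψ ∈ H¹(B_R^c)` (with differential `Ψ`) on `∂B_R`: some smooth
compactly supported functions on `ℍ^N` converge to `ψ` in `H¹(B_R^c)` while their restrictions to
`∂B_R` converge to `t` in `L²(∂B_R)`. -/
def IsTrace {N : ℕ} (R : ℝ) (ψ : E N → ℝ) (Ψ : E N → E N) (t : Sph N → ℝ) : Prop :=
  MemLp t 2 (bdryMeas N R) ∧
    ∃ φ : ℕ → E N → ℝ, (∀ n, ContDiff ℝ ∞ (φ n) ∧ HasCompactSupport (φ n)) ∧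
      Tendsto (fun n => ∫ x in extBall N R,
        ((φ n x - ψ x) ^ 2 + gradSq x (gradient (φ n) x - Ψ x)) ∂(hypVol N)) atTop (𝓝 0) ∧
      Tendsto (fun n => ∫ θ : Sph N, (φ n (R • (θ : E N)) - t θ) ^ 2 ∂(bdryMeas N R)) atTop (𝓝 0)

/-- `ψ(r, gθ) = ψ(r, θ)` almost everywhere in `B_R^c`, for all `g ∈ G`. The isometries of
`𝕊^{N-1}` are exactly the restrictions of the linear isometries of `ℝ^N`. -/
def IsSymmetric {N : ℕ} (G : Subgroup (E N ≃ₗᵢ[ℝ] E N)) (R : ℝ) (ψ : E N → ℝ) : Prop :=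
  ∀ g ∈ G, ∀ᵐ x ∂((hypVol N).restrict (extBall N R)), ψ (g x) = ψ x

/-! ### The Laplacian on `G`-symmetric functions on the sphere and hypothesis (G1) -/

/-- The action of a linear isometry on the sphere. -/
noncomputable def sphAct {N : ℕ} (g : E N ≃ₗᵢ[ℝ] E N) (θ : Sph N) : Sph N :=
  ⟨g θ, by have := mem_sphere_zero_iff_norm.1 θ.2; simp [this]⟩

/-- The extension of `f : 𝕊^{N-1} → ℝ` to `ℝ^N ∖ {0}` which is constant along rays. -/
noncomputable def radExt {N : ℕ} (f : Sph N → ℝ) (x : E N) : ℝ :=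
  if hx : x = 0 then 0
  else f ⟨‖x‖⁻¹ • x, by simp [norm_smul, hx]⟩

lemma radExt_add {N : ℕ} (f g : Sph N → ℝ) : radExt (f + g) = radExt f + radExt g := by
  funext x; by_cases hx : x = 0 <;> simp [radExt, hx]

lemma radExt_smul {N : ℕ} (c : ℝ) (f : Sph N → ℝ) : radExt (c • f) = c • radExt f := by
  funext x; by_cases hx : x = 0 <;> simp [radExt, hx]

/-- Smooth functions on the sphere. -/
def SmoothSph {N : ℕ} (f : Sph N → ℝ) : Prop := ContDiffOn ℝ ∞ (radExt f) {0}ᶜ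

/-- The Laplace–Beltrami operator of the unit sphere (on smooth functions): the Euclidean
Laplacian of the radially constant extension, at the points of the sphere. -/
noncomputable def sphLap {N : ℕ} (f : Sph N → ℝ) (θ : Sph N) : ℝ := Δ (radExt f) (θ : E N)

lemma SmoothSph.contDiffAt {N : ℕ} {f : Sph N → ℝ} (hf : SmoothSph f) (θ : Sph N) :
    ContDiffAt ℝ 2 (radExt f) (θ : E N) := by
  have h0 : (θ : E N) ≠ 0 := ne_of_mem_sphere θ.2 one_ne_zero
  have h1 : ContDiffAt ℝ ∞ (radExt f) (θ : E N) :=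
    ContDiffOn.contDiffAt hf (isOpen_compl_singleton.mem_nhds h0)
  exact h1.of_le (WithTop.coe_le_coe.2 (le_top : (2 : ℕ∞) ≤ ⊤))

/-- The `G`-symmetric eigenfunctions of `-Δ_{𝕊^{N-1}}` with eigenvalue `μ`, together with `0`. -/
noncomputable def symEigenspace {N : ℕ} (G : Subgroup (E N ≃ₗᵢ[ℝ] E N)) (μ : ℝ) :
    Submodule ℝ (Sph N → ℝ) where
  carrier := {f | SmoothSph f ∧ (∀ θ, -sphLap f θ = μ * f θ) ∧
    ∀ g ∈ G, ∀ θ, f (sphAct g θ) = f θ}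
  zero_mem' := by
    have h : radExt (0 : Sph N → ℝ) = fun _ => 0 := by
      funext x; by_cases hx : x = 0 <;> simp [radExt, hx]
    refine ⟨?_, ?_, ?_⟩
    · unfold SmoothSph; rw [h]; exact contDiffOn_const
    · intro θ
      simp [sphLap, h]
    · simp
  add_mem' := by
    rintro f₁ f₂ ⟨h₁, e₁, s₁⟩ ⟨h₂, e₂, s₂⟩
    refine ⟨?_, fun θ => ?_, fun g hg θ => ?_⟩
    · unfold SmoothSph; rw [radExt_add]; exact h₁.add h₂
    · have := e₁ θ
      have := e₂ θ
      simp only [sphLap] at *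
      rw [radExt_add, (h₁.contDiffAt θ).laplacian_add (h₂.contDiffAt θ), Pi.add_apply]
      linarith
    · simp [s₁ g hg, s₂ g hg]
  smul_mem' := by
    rintro c f ⟨h, e, s⟩
    refine ⟨?_, fun θ => ?_, fun g hg θ => ?_⟩
    · unfold SmoothSph; rw [radExt_smul]; exact h.const_smul c
    · have := e θ
      simp only [sphLap] at *
      rw [radExt_smul, InnerProductSpace.laplacian_smul c (h.contDiffAt θ), Pi.smul_apply,
        smul_eq_mul, smul_eq_mul]
      linear_combination c * this
    · simp [s g hg]

/-- The `i`-th eigenvalue `μ_i = i (i + N - 2)` of `-Δ_{𝕊^{N-1}}`. -/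
def sphEig (N i : ℕ) : ℝ := (i : ℝ) * ((i : ℝ) + (N : ℝ) - 2)

/-- Hypothesis (G1): if `i₁` is the index of the first nonzero eigenvalue `μ_{i₁}` of
`-Δ_{𝕊^{N-1}}` restricted to `G`-symmetric functions, then its multiplicity there is odd and
`i₁ > (2 - N + √((N-2)² + (16/9)(N+2)(N-1))) / 2`. -/
def G1 {N : ℕ} (G : Subgroup (E N ≃ₗᵢ[ℝ] E N)) : Prop :=
  ∃ i₁ : ℕ, IsLeast {i : ℕ | 1 ≤ i ∧ symEigenspace G (sphEig N i) ≠ ⊥} i₁ ∧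
    Odd (Module.finrank ℝ (symEigenspace G (sphEig N i₁))) ∧
    (2 - (N : ℝ) + √(((N : ℝ) - 2) ^ 2 + 16 / 9 * ((N : ℝ) + 2) * ((N : ℝ) - 1))) / 2 < (i₁ : ℝ)

/-! ### The function `z_R` -/

/-- The Laplacian of `ℍ^N` on radial functions: `f'' + (N - 1) (cosh r / sinh r) f'`. -/
noncomputable def radLap (N : ℕ) (f : ℝ → ℝ) (r : ℝ) : ℝ :=
  deriv (deriv f) r + ((N : ℝ) - 1) * (Real.cosh r / Real.sinh r) * deriv f r

/-- `u = u(r)` is a positive radial solution of `-λ Δu + u - u^p = 0` in `B_1^c`, `u = 0` on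
`∂B_1`, vanishing at infinity. -/
structure IsRadialSolution (N : ℕ) (p lam : ℝ) (u : ℝ → ℝ) : Prop where
  cont : ContinuousOn u (Set.Ici 1)
  smooth : ContDiffOn ℝ 2 u (Set.Ioi 1)
  pos : ∀ r, 1 < r → 0 < u r
  eq : ∀ r, 1 < r → -lam * radLap N u r + u r - u r ^ p = 0
  bdry : u 1 = 0
  infty : Tendsto u atTop (𝓝 0)

/-- `z = z(r)` is the positive radial eigenfunction, in `H_0^1(B_1^c)` and of `L²` norm `1`, for
the negative eigenvalue of the linearized operator `L_λ = -λ Δ + 1 - p u_λ^{p-1}`. -/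
structure IsRadialEigenfunction (N : ℕ) (p lam : ℝ) (z : ℝ → ℝ) : Prop where
  cont : ContinuousOn z (Set.Ici 1)
  smooth : ContDiffOn ℝ 2 z (Set.Ioi 1)
  pos : ∀ r, 1 < r → 0 < z r
  eq : ∃ u : ℝ → ℝ, IsRadialSolution N p lam u ∧ ∃ τ : ℝ, τ < 0 ∧ ∀ r, 1 < r →
    -lam * radLap N z r + z r - p * u r ^ (p - 1) * z r = τ * z r
  bdry : z 1 = 0
  deriv_sq : Integrable (fun x : E N => deriv z ‖x‖ ^ 2) ((hypVol N).restrict (extBall N 1))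
  norm_one : ∫ x in extBall N 1, z ‖x‖ ^ 2 ∂(hypVol N) = 1

open Classical in
/-- The eigenfunction `z_λ` (as a function of `r`). It exists and is unique on `[1, ∞)` for
`λ > 0` and `1 < p < (N + 2) / (N - 2)`. -/
noncomputable def zLam (N : ℕ) (p lam : ℝ) : ℝ → ℝ :=
  if h : ∃ z, IsRadialEigenfunction N p lam z then h.choose else 0

/-- `z_R (x) = z_λ (x / R)` with `λ = 1 / R²`. -/
noncomputable def zR (N : ℕ) (p R : ℝ) (x : E N) : ℝ := zLam N p (1 / R ^ 2) (‖x‖ / R)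

end HypExt

open HypExt

/-!
Restricted to a sphere of radius `r`, the hyperbolic energy of `ψ` splits into a radial part
`‖∂_r ψ‖²` and an angular part `sinh⁻² r ‖∇_θ ψ‖²`. A `G`-symmetric `ψ` has no components in the
spherical harmonics of degrees `1, …, i₁ - 1`, so after its spherical mean is removed the angular
part is at least `μ_{i₁} sinh⁻² r ‖ψ‖²`. Expanding `0 ≤ ‖∂_r ψ + (a / sinh r) ψ‖²` and integrating
the cross term by parts gives the trace inequality with constant `1 / a` as soon as
`a (a - (N - 2)) ≤ μ_{i₁}`; condition (G1) on the size of `i₁` allows `a = 4 (N - 1) / 3`.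

The trace is a limit of smooth functions `φ` which need not be `G`-symmetric. The low harmonics of
`φ` are the low harmonics of `φ - ψ`, so they are controlled by the distance from `φ` to `ψ`.
-/

namespace HypExt

section CompactParameter

variable {K V : Type*} [TopologicalSpace K] [CompactSpace K]
  [NormedAddCommGroup V] [NormedSpace ℝ V] [CompleteSpace V]

/- By the fundamental theorem of calculus in the Banach space `C(K, V)`: the pointwise integral
formula holds there because evaluation commutes with the Bochner integral. -/
lemma hasDerivAt_curry {F F' : C(ℝ × K, V)}
    (hF : ∀ t θ, HasDerivAt (fun s => F (s, θ)) (F' (t, θ)) t) (t : ℝ) :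
    HasDerivAt (fun s => F.curry s) (F'.curry t) t := by
  have hint (s : ℝ) : F.curry s = F.curry 0 + ∫ u in (0 : ℝ)..s, F'.curry u := by
    ext θ
    have hev : (∫ u in (0 : ℝ)..s, F'.curry u) θ = ∫ u in (0 : ℝ)..s, F' (u, θ) :=
      ((ContinuousMap.evalCLM ℝ θ).intervalIntegral_comp_comm
        (F'.curry.continuous.intervalIntegrable 0 s)).symm
    rw [ContinuousMap.add_apply, hev, intervalIntegral.integral_eq_sub_of_hasDerivAt
      (fun u _ => hF u θ) ((F'.continuous.comp (.prodMk_left θ)).intervalIntegrable 0 s)]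
    simp
  rw [funext hint]
  exact (intervalIntegral.integral_hasDerivAt_right (F'.curry.continuous.intervalIntegrable 0 t)
    (F'.curry.continuous.stronglyMeasurableAtFilter _ _)
    F'.curry.continuous.continuousAt).const_add _

variable [MeasurableSpace K] [BorelSpace K] (μ : Measure K) [IsFiniteMeasure μ]

lemma hasDerivAt_integral_of_compactSpace [SecondCountableTopologyEither K V] {F F' : C(ℝ × K, V)}
    (hF : ∀ t θ, HasDerivAt (fun s => F (s, θ)) (F' (t, θ)) t) (t : ℝ) :
    HasDerivAt (fun s => ∫ θ, F (s, θ) ∂μ) (∫ θ, F' (t, θ) ∂μ) t := by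
  let I : C(K, V) →L[ℝ] V := (L1.integralCLM (μ := μ)).comp (ContinuousMap.toLp 1 μ ℝ)
  have hI (f : C(K, V)) : I f = ∫ θ, f θ ∂μ := by
    change L1.integralCLM _ = _
    rw [← L1.integral_eq, L1.integral_eq_integral]
    exact integral_congr_ae (ContinuousMap.coeFn_toLp μ f)
  have h := I.hasFDerivAt.comp_hasDerivAt t (hasDerivAt_curry hF t)
  simpa only [hI, Function.comp_def, ContinuousMap.curry_apply] using h

end CompactParameter

instance (N : ℕ) : IsFiniteMeasure (sphMeas N) := by unfold sphMeas; infer_instance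

instance (N : ℕ) : (sphMeas N).IsOpenPosMeasure := by unfold sphMeas; infer_instance

open scoped Pointwise in
lemma measurePreserving_sphAct {N : ℕ} (g : E N ≃ₗᵢ[ℝ] E N) :
    MeasurePreserving (sphAct g) (sphMeas N) (sphMeas N) := by
  have hg : Measurable (sphAct g) := by unfold sphAct; fun_prop
  refine ⟨hg, ?_⟩
  ext s hs
  rw [Measure.map_apply hg hs, sphMeas, Measure.toSphere_apply' _ (hg hs),
    Measure.toSphere_apply' _ hs]
  have cone_preimage : Set.Ioo (0 : ℝ) 1 • ((↑) '' (sphAct g ⁻¹' s) : Set (E N))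
      = g ⁻¹' (Set.Ioo (0 : ℝ) 1 • ((↑) '' s : Set (E N))) := by
    have himage : ((↑) '' (sphAct g ⁻¹' s) : Set (E N)) = g.symm '' ((↑) '' s) := by
      ext x
      simp [sphAct, g.symm_apply_eq]
    rw [himage, ← Set.image2_smul, ← Set.image2_smul, show ⇑g ⁻¹' _ = g.symm '' _ from
      (g.toEquiv.image_symm_eq_preimage _).symm]
    exact (Set.image_image2_distrib_right fun c x => map_smul g.symm c x).symm
  rw [cone_preimage,
    g.measurePreserving.measure_preimage_emb g.toHomeomorph.measurableEmbedding]

section Rotations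

variable {N : ℕ} {A : E N →L[ℝ] E N}

/- The flow `exp (tA)` consists of rotations, so the integral of `f ∘ exp (tA)` over the sphere does
not depend on `t`. -/
lemma integral_fderiv_skewAdjoint (hA : A ∈ skewAdjoint (E N →L[ℝ] E N)) {f : E N → ℝ}
    (hf : ContDiff ℝ 1 f) : ∫ θ : Sph N, fderiv ℝ f θ (A θ) ∂(sphMeas N) = 0 := by
  let : NormedAlgebra ℚ (E N →L[ℝ] E N) := .restrictScalars ℚ ℝ _
  have hexp (t : ℝ) : HasDerivAt (fun s : ℝ => NormedSpace.exp (s • A))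
      (NormedSpace.exp (t • A) * A) t := hasDerivAt_exp_smul_const A t
  have hderiv := hasDerivAt_integral_of_compactSpace (sphMeas N)
    (F := ⟨fun z => f (NormedSpace.exp (z.1 • A) z.2), hf.continuous.comp (by fun_prop)⟩)
    (F' := ⟨fun z => fderiv ℝ f (NormedSpace.exp (z.1 • A) z.2)
      ((NormedSpace.exp (z.1 • A) * A) z.2), by fun_prop⟩)
    (fun t θ => (hf.differentiable one_ne_zero _).hasFDerivAt.comp_hasDerivAt t
      ((hexp t).clm_apply (hasDerivAt_const t (θ : E N)) |>.congr_deriv (by simp))) 0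
  have hinv (t : ℝ) : ∫ θ : Sph N, f (NormedSpace.exp (t • A) θ) ∂(sphMeas N)
      = ∫ θ : Sph N, f θ ∂(sphMeas N) := by
    let u : unitary (E N →L[ℝ] E N) := ⟨NormedSpace.exp (t • A),
      NormedSpace.exp_mem_unitary_of_mem_skewAdjoint (skewAdjoint.smul_mem t hA)⟩
    have hu := measurePreserving_sphAct (Unitary.linearIsometryEquiv u)
    have hfs : Continuous fun θ : Sph N => f θ := hf.continuous.comp continuous_subtype_val
    conv_rhs => rw [← hu.map_eq, integral_map hu.aemeasurable hfs.aestronglyMeasurable]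
    rfl
  simp only [ContinuousMap.coe_mk, hinv] at hderiv
  have hexp_zero : NormedSpace.exp ((0 : ℝ) • A) = 1 := by
    rw [show (0 : ℝ) • A = 0 from zero_smul ℝ A, NormedSpace.exp_zero]
  simpa [hexp_zero] using hderiv.unique (hasDerivAt_const _ _)

end Rotations

section Rotations
variable {N : ℕ}

/-- The infinitesimal rotation `x ↦ x_i e_j - x_j e_i`. -/
noncomputable def rotGen (i j : Fin N) : E N →L[ℝ] E N :=
  (EuclideanSpace.proj i : E N →L[ℝ] ℝ).smulRight (EuclideanSpace.single j 1)
    - (EuclideanSpace.proj j : E N →L[ℝ] ℝ).smulRight (EuclideanSpace.single i 1)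

lemma rotGen_apply (i j : Fin N) (x : E N) :
    rotGen i j x = x i • EuclideanSpace.single j 1 - x j • EuclideanSpace.single i 1 := by
  simp [rotGen]

lemma inner_rotGen_left (i j : Fin N) (x y : E N) :
    ⟪rotGen i j x, y⟫_ℝ = -⟪x, rotGen i j y⟫_ℝ := by
  simp only [rotGen_apply, inner_sub_left, inner_sub_right, real_inner_smul_left,
    real_inner_smul_right, EuclideanSpace.inner_single_left, EuclideanSpace.inner_single_right,
    map_one, one_mul, conj_trivial]
  ring

lemma rotGen_mem_skewAdjoint (i j : Fin N) : rotGen i j ∈ skewAdjoint (E N →L[ℝ] E N) := by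
  rw [skewAdjoint.mem_iff, ContinuousLinearMap.star_eq_adjoint, eq_comm,
    ContinuousLinearMap.eq_adjoint_iff]
  intro x y
  simp [inner_rotGen_left]

lemma sum_bilin_rotGen (B : E N →L[ℝ] E N →L[ℝ] ℝ) (x y : E N) :
    ∑ i, ∑ j, B (rotGen i j x) (rotGen i j y) =
      2 * (⟪x, y⟫_ℝ * ∑ i, B (EuclideanSpace.single i 1) (EuclideanSpace.single i 1) - B y x) := by
  let e : Fin N → E N := fun i => EuclideanSpace.single i 1
  have hB : B y x = ∑ i, ∑ j, y i * x j * B (e i) (e j) := by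
    have hrepr (z : E N) : ∑ i, z i • e i = z := by
      simpa using (EuclideanSpace.basisFun (Fin N) ℝ).sum_repr z
    conv_lhs => rw [← hrepr y, ← hrepr x]
    simp only [map_sum, map_smul, sum_apply, _root_.smul_apply, smul_eq_mul, Finset.mul_sum]
    rw [Finset.sum_comm]
    simp only [← mul_assoc, mul_comm]
  have hterm (i j : Fin N) : B (rotGen i j x) (rotGen i j y) =
      x i * y i * B (e j) (e j) + x j * y j * B (e i) (e i)
        - (y i * x j * B (e i) (e j) + y j * x i * B (e j) (e i)) := by
    simp only [rotGen_apply, map_sub, map_smul, _root_.sub_apply, _root_.smul_apply, smul_eq_mul]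
    ring
  have hswap : ∑ i, ∑ j, y j * x i * B (e j) (e i) = B y x := by rw [hB, Finset.sum_comm]
  have hinner : ⟪x, y⟫_ℝ = ∑ i, x i * y i := by simp [PiLp.inner_apply, mul_comm]
  simp_rw [hterm, Finset.sum_sub_distrib, Finset.sum_add_distrib, hswap, ← hB, ← Finset.mul_sum,
    ← Finset.sum_mul, hinner, ← Finset.mul_sum]
  ring

lemma sum_rotGen_rotGen (x : E N) :
    ∑ i, ∑ j, rotGen i j (rotGen i j x) = (-2 * ((N : ℝ) - 1)) • x := by
  refine ext_inner_right ℝ fun y => ?_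
  have h : ∑ i, ∑ j, ⟪rotGen i j x, rotGen i j y⟫_ℝ = 2 * (⟪x, y⟫_ℝ * ∑ i : Fin N,
      ⟪(EuclideanSpace.single i 1 : E N), EuclideanSpace.single i 1⟫_ℝ - ⟪y, x⟫_ℝ) :=
    sum_bilin_rotGen (innerSL ℝ) x y
  simp only [real_inner_self_eq_norm_sq, PiLp.norm_single, norm_one, one_pow, Finset.sum_const,
    Finset.card_univ, Fintype.card_fin, nsmul_eq_mul, mul_one, real_inner_comm x y] at h
  simp_rw [sum_inner, fun i j => inner_rotGen_left i j (rotGen i j x) y, Finset.sum_neg_distrib, h,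
    real_inner_smul_left]
  ring

/-- The derivative of `F` along the infinitesimal rotation `rotGen i j`. -/
noncomputable def rotDeriv (i j : Fin N) (F : E N → ℝ) (x : E N) : ℝ :=
  fderiv ℝ F x (rotGen i j x)

/-- The rotational Laplacian `∑_{i < j} (x_i ∂_j - x_j ∂_i)²`, which acts on the values of `F` on
each sphere centred at the origin. -/
noncomputable def rotLap (F : E N → ℝ) (x : E N) : ℝ :=
  1 / 2 * ∑ i, ∑ j, rotDeriv i j (rotDeriv i j F) x

lemma contDiff_rotDeriv {n : WithTop ℕ∞} {F : E N → ℝ} (hF : ContDiff ℝ (n + 1) F) (i j : Fin N) :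
    ContDiff ℝ n (rotDeriv i j F) :=
  (hF.fderiv_right le_rfl).clm_apply (rotGen i j).contDiff

lemma continuous_rotDeriv {F : E N → ℝ} (hF : ContDiff ℝ 1 F) (i j : Fin N) :
    Continuous (rotDeriv i j F) :=
  (contDiff_rotDeriv (n := 0) hF i j).continuous

lemma rotDeriv_rotDeriv {F : E N → ℝ} {x : E N} (hF : ContDiffAt ℝ 2 F x) (i j : Fin N) :
    rotDeriv i j (rotDeriv i j F) x =
      fderiv ℝ (fderiv ℝ F) x (rotGen i j x) (rotGen i j x)
        + fderiv ℝ F x (rotGen i j (rotGen i j x)) := by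
  have hd : HasFDerivAt (fderiv ℝ F) (fderiv ℝ (fderiv ℝ F) x) x :=
    ((hF.fderiv_right (m := 1) le_rfl).differentiableAt one_ne_zero).hasFDerivAt
  rw [rotDeriv, show rotDeriv i j F = fun y => fderiv ℝ F y (rotGen i j y) from rfl,
    (hd.clm_apply (rotGen i j).hasFDerivAt).fderiv]
  simp [add_comm]

/-- The Euler operator `r ∂_r`. -/
noncomputable def eulerDeriv (F : E N → ℝ) (x : E N) : ℝ := fderiv ℝ F x x

lemma eulerDeriv_eulerDeriv {F : E N → ℝ} {x : E N} (hF : ContDiffAt ℝ 2 F x) :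
    eulerDeriv (eulerDeriv F) x = fderiv ℝ (fderiv ℝ F) x x x + eulerDeriv F x := by
  have hd : HasFDerivAt (fderiv ℝ F) (fderiv ℝ (fderiv ℝ F) x) x :=
    ((hF.fderiv_right (m := 1) le_rfl).differentiableAt one_ne_zero).hasFDerivAt
  have hE : HasFDerivAt (eulerDeriv F) _ x := hd.clm_apply (hasFDerivAt_id x)
  rw [eulerDeriv, hE.fderiv]
  simp [add_comm, eulerDeriv]

lemma rotLap_eq {F : E N → ℝ} {x : E N} (hF : ContDiffAt ℝ 2 F x) :
    rotLap F x = ‖x‖ ^ 2 * Δ F x - eulerDeriv (eulerDeriv F) x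
      - ((N : ℝ) - 2) * eulerDeriv F x := by
  have hΔ : Δ F x = ∑ i, fderiv ℝ (fderiv ℝ F) x (EuclideanSpace.single i 1)
      (EuclideanSpace.single i 1) := by
    rw [InnerProductSpace.laplacian_eq_iteratedFDeriv_orthonormalBasis F
      (EuclideanSpace.basisFun (Fin N) ℝ)]
    simp [iteratedFDeriv_two_apply]
  have hsum : ∑ i, ∑ j, fderiv ℝ F x (rotGen i j (rotGen i j x))
      = -2 * ((N : ℝ) - 1) * eulerDeriv F x := by
    simp_rw [← map_sum, sum_rotGen_rotGen, map_smul, smul_eq_mul, eulerDeriv]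
  simp_rw [rotLap, rotDeriv_rotDeriv hF, Finset.sum_add_distrib, hsum, sum_bilin_rotGen, hΔ,
    real_inner_self_eq_norm_sq, eulerDeriv_eulerDeriv hF]
  ring

lemma integrable_sphMeas {f : Sph N → ℝ} (hf : Continuous f) : Integrable f (sphMeas N) :=
  hf.integrable_of_hasCompactSupport (.of_compactSpace _)

lemma integral_rotDeriv_mul {f g : E N → ℝ} (hf : ContDiff ℝ 1 f) (hg : ContDiff ℝ 1 g)
    (i j : Fin N) : ∫ θ : Sph N, rotDeriv i j f θ * g θ ∂(sphMeas N)
      = -∫ θ : Sph N, f θ * rotDeriv i j g θ ∂(sphMeas N) := by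
  have hleibniz (x : E N) : fderiv ℝ (fun y => f y * g y) x (rotGen i j x)
      = rotDeriv i j f x * g x + f x * rotDeriv i j g x := by
    rw [fderiv_fun_mul (hf.differentiable one_ne_zero _) (hg.differentiable one_ne_zero _)]
    simp only [rotDeriv, _root_.add_apply, _root_.smul_apply, smul_eq_mul]
    ring
  have hint : Integrable (fun θ : Sph N => rotDeriv i j f θ * g θ) (sphMeas N) :=
    integrable_sphMeas
      (((continuous_rotDeriv hf i j).mul hg.continuous).comp continuous_subtype_val)
  have hint' : Integrable (fun θ : Sph N => f θ * rotDeriv i j g θ) (sphMeas N) :=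
    integrable_sphMeas
      ((hf.continuous.mul (continuous_rotDeriv hg i j)).comp continuous_subtype_val)
  have hzero := integral_fderiv_skewAdjoint (rotGen_mem_skewAdjoint i j) (hf.mul hg)
  simp_rw [hleibniz, integral_add hint hint'] at hzero
  exact eq_neg_of_add_eq_zero_left hzero

/-- The Dirichlet form `∫ ⟨∇_θ f, ∇_θ g⟩` of the unit sphere. -/
noncomputable def sphDirichlet (f g : E N → ℝ) : ℝ :=
  1 / 2 * ∑ i, ∑ j, ∫ θ : Sph N, rotDeriv i j f θ * rotDeriv i j g θ ∂(sphMeas N)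

lemma sphDirichlet_comm (f g : E N → ℝ) : sphDirichlet f g = sphDirichlet g f := by
  simp_rw [sphDirichlet, mul_comm (rotDeriv _ _ f _)]

lemma sphDirichlet_self_nonneg (f : E N → ℝ) : 0 ≤ sphDirichlet f f :=
  mul_nonneg (by norm_num) (Finset.sum_nonneg fun _ _ => Finset.sum_nonneg fun _ _ =>
    integral_nonneg fun _ => mul_self_nonneg _)

lemma integral_rotLap_mul {f g : E N → ℝ} (hf : ContDiff ℝ 2 f) (hg : ContDiff ℝ 1 g) :
    ∫ θ : Sph N, rotLap f θ * g θ ∂(sphMeas N) = -sphDirichlet f g := by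
  have hf' (i j : Fin N) : ContDiff ℝ 1 (rotDeriv i j f) := contDiff_rotDeriv hf i j
  have hint (i j : Fin N) : Integrable
      (fun θ : Sph N => rotDeriv i j (rotDeriv i j f) θ * g θ) (sphMeas N) :=
    integrable_sphMeas
      (((continuous_rotDeriv (hf' i j) i j).mul hg.continuous).comp continuous_subtype_val)
  simp_rw [rotLap, mul_assoc, Finset.sum_mul, integral_const_mul]
  rw [integral_finsetSum _ fun i _ => integrable_finsetSum _ fun j _ => hint i j]
  simp_rw [integral_finsetSum _ fun j _ => hint _ j, integral_rotDeriv_mul (hf' _ _) hg,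
    Finset.sum_neg_distrib, mul_neg, sphDirichlet]

lemma sphDirichlet_sub_self {f g : E N → ℝ} (hf : ContDiff ℝ 1 f) (hg : ContDiff ℝ 1 g) :
    sphDirichlet (fun x => f x - g x) (fun x => f x - g x)
      = sphDirichlet f f - 2 * sphDirichlet g f + sphDirichlet g g := by
  have hint {u v : E N → ℝ} (hu : ContDiff ℝ 1 u) (hv : ContDiff ℝ 1 v) (i j : Fin N) :
      Integrable (fun θ : Sph N => rotDeriv i j u θ * rotDeriv i j v θ) (sphMeas N) :=
    integrable_sphMeas
      (((continuous_rotDeriv hu i j).mul (continuous_rotDeriv hv i j)).comp continuous_subtype_val)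
  have hexpand (i j : Fin N) : ∫ θ : Sph N, rotDeriv i j (fun x => f x - g x) θ
        * rotDeriv i j (fun x => f x - g x) θ ∂(sphMeas N)
      = ∫ θ : Sph N, rotDeriv i j f θ * rotDeriv i j f θ ∂(sphMeas N)
        - 2 * ∫ θ : Sph N, rotDeriv i j g θ * rotDeriv i j f θ ∂(sphMeas N)
        + ∫ θ : Sph N, rotDeriv i j g θ * rotDeriv i j g θ ∂(sphMeas N) := by
    rw [← integral_const_mul, ← integral_sub (hint hf hf i j) ((hint hg hf i j).const_mul 2),
      ← integral_add _ (hint hg hg i j)]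
    swap
    · exact (hint hf hf i j).sub ((hint hg hf i j).const_mul 2)
    refine integral_congr_ae (.of_forall fun θ => ?_)
    simp only [rotDeriv, fderiv_fun_sub (hf.differentiable one_ne_zero _)
      (hg.differentiable one_ne_zero _), _root_.sub_apply]
    ring
  simp_rw [sphDirichlet, hexpand, Finset.sum_add_distrib, Finset.sum_sub_distrib, ← Finset.mul_sum]
  ring

end Rotations

section RadialExtension
variable {N : ℕ}

lemma hasFDerivAt_norm_inv_smul {x : E N} (hx : x ≠ 0) :
    HasFDerivAt (fun y : E N => ‖y‖⁻¹ • y)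
      (‖x‖⁻¹ • (ContinuousLinearMap.id ℝ (E N) - (‖x‖⁻¹ ^ 2 • innerSL ℝ x).smulRight x)) x := by
  have hx' : ‖x‖ ≠ 0 := norm_ne_zero_iff.2 hx
  have hnorm := (hasStrictFDerivAt_norm_sq x).hasFDerivAt.sqrt (by positivity)
  simp only [Real.sqrt_sq (norm_nonneg _)] at hnorm
  refine ((hasDerivAt_inv hx').comp_hasFDerivAt x hnorm |>.smul (hasFDerivAt_id x)).congr_fderiv ?_
  ext v i
  simp [field]
  ring

lemma radExt_coe_of_ne_zero (F : E N → ℝ) {x : E N} (hx : x ≠ 0) :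
    radExt (fun θ => F θ) x = F (‖x‖⁻¹ • x) := by
  simp [radExt, hx]

lemma radExt_coe_eventuallyEq (F : E N → ℝ) {x : E N} (hx : x ≠ 0) :
    radExt (fun θ => F θ) =ᶠ[𝓝 x] fun y => F (‖y‖⁻¹ • y) :=
  (eventually_ne_nhds hx).mono fun _ hy => radExt_coe_of_ne_zero F hy

lemma smoothSph_coe {F : E N → ℝ} (hF : ContDiff ℝ ∞ F) : SmoothSph fun θ : Sph N => F θ := by
  refine ContDiffOn.congr (f := fun y => F (‖y‖⁻¹ • y)) ?_ fun x hx => radExt_coe_of_ne_zero F hx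
  exact fun x hx => (hF.contDiffAt.comp x
    (((contDiffAt_norm ℝ hx).inv (norm_ne_zero_iff.2 hx)).smul contDiffAt_id)).contDiffWithinAt

lemma fderiv_radExt_coe {F : E N → ℝ} (hF : Differentiable ℝ F) {x : E N} (hx : x ≠ 0) (v : E N) :
    fderiv ℝ (radExt fun θ => F θ) x v
      = fderiv ℝ F (‖x‖⁻¹ • x) (‖x‖⁻¹ • (v - (‖x‖⁻¹ ^ 2 * ⟪x, v⟫_ℝ) • x)) := by
  have hcomp := HasFDerivAt.comp (g := F) x (hF _).hasFDerivAt (hasFDerivAt_norm_inv_smul hx)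
  exact DFunLike.congr_fun (hcomp.congr_of_eventuallyEq (radExt_coe_eventuallyEq F hx)).fderiv v

lemma eulerDeriv_radExt {F : E N → ℝ} (hF : Differentiable ℝ F) {x : E N} (hx : x ≠ 0) :
    eulerDeriv (radExt fun θ => F θ) x = 0 := by
  have : ‖x‖ ≠ 0 := norm_ne_zero_iff.2 hx
  rw [eulerDeriv, fderiv_radExt_coe hF hx, real_inner_self_eq_norm_sq, ← mul_pow,
    inv_mul_cancel₀ this]
  simp

lemma rotDeriv_radExt {F : E N → ℝ} (hF : Differentiable ℝ F) {x : E N} (hx : x ≠ 0)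
    (i j : Fin N) :
    rotDeriv i j (radExt fun θ => F θ) x = radExt (fun θ => rotDeriv i j F θ) x := by
  have horth : ⟪x, rotGen i j x⟫_ℝ = 0 := by
    have := inner_rotGen_left i j x x
    rw [real_inner_comm] at this
    linarith
  rw [rotDeriv, fderiv_radExt_coe hF hx, horth, radExt_coe_of_ne_zero _ hx, rotDeriv]
  simp

lemma sphLap_coe {F : E N → ℝ} (hF : ContDiff ℝ ∞ F) (θ : Sph N) :
    sphLap (fun θ => F θ) θ = rotLap F θ := by
  have hθ : (θ : E N) ≠ 0 := ne_of_mem_sphere θ.2 one_ne_zero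
  have hF₁ : Differentiable ℝ F := hF.differentiable (by simp)
  have hrot (i j : Fin N) : rotDeriv i j (rotDeriv i j (radExt fun θ => F θ)) θ
      = rotDeriv i j (rotDeriv i j F) θ := by
    have hev : rotDeriv i j (radExt fun θ => F θ) =ᶠ[𝓝 (θ : E N)]
        radExt fun θ => rotDeriv i j F θ :=
      (eventually_ne_nhds hθ).mono fun _ hy => rotDeriv_radExt hF₁ hy i j
    rw [rotDeriv, hev.fderiv_eq, ← rotDeriv, rotDeriv_radExt
      ((contDiff_rotDeriv (n := ∞) hF i j).differentiable (by simp)) hθ, radExt_coe_of_ne_zero _ hθ]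
    simp
  have heuler : eulerDeriv (radExt fun θ => F θ) =ᶠ[𝓝 (θ : E N)] fun _ => 0 :=
    (eventually_ne_nhds hθ).mono fun _ hy => eulerDeriv_radExt hF₁ hy
  have hsum := rotLap_eq ((smoothSph_coe hF).contDiffAt θ)
  rw [heuler.self_of_nhds, eulerDeriv, heuler.fderiv_eq] at hsum
  simpa [rotLap, hrot, sphLap] using hsum.symm

end RadialExtension

section Polynomials
variable {N : ℕ}
open MvPolynomial

/-- The polynomial functions on `ℝ^N`. -/
noncomputable def polyFun (N : ℕ) : MvPolynomial (Fin N) ℝ →ₐ[ℝ] C(E N, ℝ) :=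
  aeval fun i => ⟨fun x => x i, by fun_prop⟩

lemma coe_polyFun_C (a : ℝ) : ⇑(polyFun N (C a)) = fun _ => a := by ext x; simp [polyFun]

lemma coe_polyFun_X (i : Fin N) : ⇑(polyFun N (X i)) = EuclideanSpace.proj (𝕜 := ℝ) i := by
  ext x; simp [polyFun]

lemma contDiff_polyFun (p : MvPolynomial (Fin N) ℝ) : ContDiff ℝ ∞ (polyFun N p) := by
  induction p using MvPolynomial.induction_on with
  | C a => rw [coe_polyFun_C]; exact contDiff_const
  | add p q hp hq => rw [map_add]; exact hp.add hq
  | mul_X p i hp =>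
    rw [map_mul, ContinuousMap.coe_mul, coe_polyFun_X]
    exact hp.mul (EuclideanSpace.proj (𝕜 := ℝ) i).contDiff

lemma fderiv_polyFun (p : MvPolynomial (Fin N) ℝ) (x v : E N) :
    fderiv ℝ (polyFun N p) x v = ∑ i, v i * polyFun N (pderiv i p) x := by
  have hdiff (q : MvPolynomial (Fin N) ℝ) : DifferentiableAt ℝ (polyFun N q) x :=
    (contDiff_polyFun q).differentiable (by simp) x
  induction p using MvPolynomial.induction_on with
  | C a => rw [coe_polyFun_C]; simp
  | add p q hp hq =>
    rw [map_add, ContinuousMap.coe_add, fderiv_add (hdiff p) (hdiff q)]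
    simp [hp, hq, mul_add, Finset.sum_add_distrib]
  | mul_X p i hp =>
    have hX : fderiv ℝ (polyFun N (X i)) x v = ∑ j, v j * polyFun N (pderiv j (X i)) x := by
      rw [coe_polyFun_X, ContinuousLinearMap.fderiv,
        Finset.sum_eq_single i (fun j _ hj => by simp [pderiv_X_of_ne hj.symm]) (by simp)]
      simp
    rw [map_mul, ContinuousMap.coe_mul, fderiv_mul (hdiff p) (hdiff _), _root_.add_apply,
      _root_.smul_apply, _root_.smul_apply, hp, hX, smul_eq_mul, smul_eq_mul, Finset.mul_sum,
      Finset.mul_sum, ← Finset.sum_add_distrib]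
    refine Finset.sum_congr rfl fun j _ => ?_
    rw [pderiv_mul, map_add, map_mul, map_mul, ContinuousMap.add_apply, ContinuousMap.mul_apply,
      ContinuousMap.mul_apply]
    ring

lemma laplacian_polyFun (p : MvPolynomial (Fin N) ℝ) (x : E N) :
    Δ (⇑(polyFun N p)) x = ∑ i, polyFun N (pderiv i (pderiv i p)) x := by
  have hpart (q : MvPolynomial (Fin N) ℝ) (i : Fin N) (y : E N) :
      fderiv ℝ (polyFun N q) y (EuclideanSpace.single i 1) = polyFun N (pderiv i q) y := by
    simp [fderiv_polyFun]
  rw [InnerProductSpace.laplacian_eq_iteratedFDeriv_orthonormalBasis _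
    (EuclideanSpace.basisFun (Fin N) ℝ)]
  refine Finset.sum_congr rfl fun i _ => ?_
  have hd : DifferentiableAt ℝ (fderiv ℝ (polyFun N p)) x :=
    ((contDiff_polyFun p).fderiv_right (m := 1) (by norm_cast)).differentiable one_ne_zero x
  rw [iteratedFDeriv_two_apply, ← hpart, ← funext (hpart p i), fderiv_clm_apply hd (by fun_prop)]
  simp

/-- The Euler operator on polynomials. -/
noncomputable def polyEuler (N : ℕ) : MvPolynomial (Fin N) ℝ →ₗ[ℝ] MvPolynomial (Fin N) ℝ :=
  ∑ i, LinearMap.mulLeft ℝ (X i) ∘ₗ (pderiv i).toLinearMap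

/-- The Laplacian on polynomials. -/
noncomputable def polyLap (N : ℕ) : MvPolynomial (Fin N) ℝ →ₗ[ℝ] MvPolynomial (Fin N) ℝ :=
  ∑ i, (pderiv i).toLinearMap ∘ₗ (pderiv i).toLinearMap

/-- The Laplacian of the unit sphere on polynomials: on the sphere, `polySphLap p` takes the values
of the rotational Laplacian of `p`. -/
noncomputable def polySphLap (N : ℕ) : MvPolynomial (Fin N) ℝ →ₗ[ℝ] MvPolynomial (Fin N) ℝ :=
  polyLap N - polyEuler N ∘ₗ polyEuler N - ((N : ℝ) - 2) • polyEuler N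

lemma eulerDeriv_polyFun (p : MvPolynomial (Fin N) ℝ) :
    eulerDeriv (polyFun N p) = ⇑(polyFun N (polyEuler N p)) := by
  ext x
  simp [eulerDeriv, fderiv_polyFun, polyEuler, coe_polyFun_X]

lemma rotLap_polyFun (p : MvPolynomial (Fin N) ℝ) (θ : Sph N) :
    rotLap (polyFun N p) θ = polyFun N (polySphLap N p) θ := by
  rw [rotLap_eq ((contDiff_polyFun p).contDiffAt.of_le (by norm_cast)), eulerDeriv_polyFun,
    eulerDeriv_polyFun, laplacian_polyFun, norm_eq_of_mem_sphere]
  simp [polySphLap, polyLap]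

lemma coeff_polyEuler (p : MvPolynomial (Fin N) ℝ) (s : Fin N →₀ ℕ) :
    coeff s (polyEuler N p) = s.degree * coeff s p := by
  induction p using MvPolynomial.induction_on' with
  | monomial t a =>
    have h := (isHomogeneous_monomial (d := t) a rfl).sum_X_mul_pderiv
    have h' : polyEuler N (monomial t a) = t.degree • monomial t a := by
      simpa [polyEuler] using h
    rw [h', coeff_smul, coeff_monomial, nsmul_eq_mul]
    split_ifs with hts
    · rw [hts]
    · simp
  | add p q hp hq => rw [map_add, coeff_add, coeff_add, hp, hq, mul_add]

lemma mem_restrictTotalDegree_iff_coeff {m : ℕ} {p : MvPolynomial (Fin N) ℝ} :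
    p ∈ restrictTotalDegree (Fin N) ℝ m ↔ ∀ s : Fin N →₀ ℕ, m < s.degree → coeff s p = 0 := by
  rw [mem_restrictTotalDegree, totalDegree, Finset.sup_le_iff]
  exact forall_congr' fun s => by rw [mem_support_iff, not_imp_comm, not_le]; rfl

lemma polyEuler_mem {m : ℕ} {p : MvPolynomial (Fin N) ℝ}
    (hp : p ∈ restrictTotalDegree (Fin N) ℝ m) :
    polyEuler N p ∈ restrictTotalDegree (Fin N) ℝ m := by
  rw [mem_restrictTotalDegree_iff_coeff] at hp ⊢
  exact fun s hs => by rw [coeff_polyEuler, hp s hs, mul_zero]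

lemma polyEuler_sub_mem {m : ℕ} {p : MvPolynomial (Fin N) ℝ}
    (hp : p ∈ restrictTotalDegree (Fin N) ℝ (m + 1)) :
    polyEuler N p - ((m : ℝ) + 1) • p ∈ restrictTotalDegree (Fin N) ℝ m := by
  rw [mem_restrictTotalDegree_iff_coeff] at hp ⊢
  intro s hs
  rw [coeff_sub, coeff_smul, coeff_polyEuler, smul_eq_mul]
  obtain h | h := (Nat.succ_le_of_lt hs).eq_or_lt
  · rw [← h]; push_cast; ring
  · rw [hp s h]; ring

lemma polyLap_mem {m : ℕ} {p : MvPolynomial (Fin N) ℝ}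
    (hp : p ∈ restrictTotalDegree (Fin N) ℝ (m + 1)) :
    polyLap N p ∈ restrictTotalDegree (Fin N) ℝ m := by
  rw [mem_restrictTotalDegree_iff_coeff] at hp ⊢
  intro s hs
  simp only [polyLap, LinearMap.coe_sum, Finset.sum_apply, LinearMap.comp_apply,
    Derivation.coeFn_coe, coeff_sum, coeff_pderiv]
  refine Finset.sum_eq_zero fun i _ => ?_
  rw [hp _ (by simp; omega), zero_mul, zero_mul]

lemma polySphLap_mem {m : ℕ} {p : MvPolynomial (Fin N) ℝ}
    (hp : p ∈ restrictTotalDegree (Fin N) ℝ m) :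
    polySphLap N p ∈ restrictTotalDegree (Fin N) ℝ m := by
  have hle : p ∈ restrictTotalDegree (Fin N) ℝ (m + 1) := by
    rw [mem_restrictTotalDegree] at hp ⊢; omega
  exact sub_mem (sub_mem (polyLap_mem hle) (polyEuler_mem (polyEuler_mem hp)))
    (Submodule.smul_mem _ _ (polyEuler_mem hp))

/- With `e` the Euler operator, `e² + (N - 2)e - μ_k = (e + (k + N - 2))(e - k)`, and `e - k` lowers
the degree of a polynomial of degree `k`. -/
lemma polySphLap_add_smul_mem {m : ℕ} {p : MvPolynomial (Fin N) ℝ}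
    (hp : p ∈ restrictTotalDegree (Fin N) ℝ (m + 1)) :
    polySphLap N p + sphEig N (m + 1) • p ∈ restrictTotalDegree (Fin N) ℝ m := by
  let q := polyEuler N p - ((m : ℝ) + 1) • p
  have hfactor : polySphLap N p + sphEig N (m + 1) • p
      = polyLap N p - (polyEuler N q + ((m : ℝ) + N - 1) • q) := by
    simp only [polySphLap, sphEig, q, LinearMap.sub_apply, LinearMap.smul_apply,
      LinearMap.comp_apply, map_sub, map_smul]
    push_cast
    module
  have hq : q ∈ restrictTotalDegree (Fin N) ℝ m := polyEuler_sub_mem hp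
  rw [hfactor]
  exact sub_mem (polyLap_mem hp) (add_mem (polyEuler_mem hq) (Submodule.smul_mem _ _ hq))

end Polynomials

section SpectralGap
variable {N : ℕ}
open MvPolynomial

/-- The class in `L²(𝕊^{N-1})` of a continuous function. -/
noncomputable def toL2 (N : ℕ) : C(Sph N, ℝ) →L[ℝ] Lp ℝ 2 (sphMeas N) :=
  ContinuousMap.toLp 2 (sphMeas N) ℝ

lemma coeFn_toL2 (f : C(Sph N, ℝ)) : toL2 N f =ᵐ[sphMeas N] f :=
  ContinuousMap.coeFn_toLp (sphMeas N) f

lemma inner_toL2 (f g : C(Sph N, ℝ)) :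
    ⟪toL2 N f, toL2 N g⟫_ℝ = ∫ θ, f θ * g θ ∂(sphMeas N) := by
  rw [toL2, ContinuousMap.inner_toLp]
  simp [mul_comm]

lemma norm_toL2_sq (f : C(Sph N, ℝ)) : ‖toL2 N f‖ ^ 2 = ∫ θ, f θ ^ 2 ∂(sphMeas N) := by
  rw [← real_inner_self_eq_norm_sq, inner_toL2]
  simp_rw [sq]

/-- The restrictions of polynomials to the sphere. -/
noncomputable def polySph (N : ℕ) : MvPolynomial (Fin N) ℝ →ₐ[ℝ] C(Sph N, ℝ) :=
  (ContinuousMap.compRightAlgHom ℝ ℝ ⟨Subtype.val, continuous_subtype_val⟩).comp (polyFun N)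

lemma polySph_apply (p : MvPolynomial (Fin N) ℝ) (θ : Sph N) : polySph N p θ = polyFun N p θ := rfl

/-- The class in `L²(𝕊^{N-1})` of a polynomial. -/
noncomputable def polyClass (N : ℕ) : MvPolynomial (Fin N) ℝ →ₗ[ℝ] Lp ℝ 2 (sphMeas N) :=
  (toL2 N).toLinearMap ∘ₗ (polySph N).toLinearMap

lemma polyClass_apply (p : MvPolynomial (Fin N) ℝ) : polyClass N p = toL2 N (polySph N p) := rfl

lemma polyClass_eq_iff {p q : MvPolynomial (Fin N) ℝ} :
    polyClass N p = polyClass N q ↔ ∀ θ : Sph N, polyFun N p θ = polyFun N q θ := by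
  rw [polyClass_apply, polyClass_apply, toL2, (ContinuousMap.toLp_injective (sphMeas N)).eq_iff,
    ContinuousMap.ext_iff]
  rfl

/-- The classes in `L²(𝕊^{N-1})` of the polynomials of degree at most `m`. -/
noncomputable def polyL2 (N m : ℕ) : Submodule ℝ (Lp ℝ 2 (sphMeas N)) :=
  (restrictTotalDegree (Fin N) ℝ m).map (polyClass N)

instance finiteDimensional_polyL2 (m : ℕ) : FiniteDimensional ℝ (polyL2 N m) := by
  unfold polyL2; infer_instance

lemma polyClass_mem {m : ℕ} {p : MvPolynomial (Fin N) ℝ}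
    (hp : p ∈ restrictTotalDegree (Fin N) ℝ m) : polyClass N p ∈ polyL2 N m :=
  Submodule.mem_map_of_mem hp

lemma polyL2_mono (N : ℕ) : Monotone (polyL2 N) := fun m k hmk => Submodule.map_mono fun p hp => by
  rw [mem_restrictTotalDegree] at hp ⊢
  exact hp.trans hmk

lemma exists_polyClass_eq_starProjection (m : ℕ) (x : Lp ℝ 2 (sphMeas N)) :
    ∃ p ∈ restrictTotalDegree (Fin N) ℝ m, polyClass N p = (polyL2 N m).starProjection x :=
  (polyL2 N m).starProjection_apply_mem x

lemma inner_polySphLap_toL2 (p : MvPolynomial (Fin N) ℝ) {f : E N → ℝ} (hf : ContDiff ℝ 1 f)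
    {c : C(Sph N, ℝ)} (hc : ∀ θ : Sph N, c θ = f θ) :
    ⟪polyClass N (polySphLap N p), toL2 N c⟫_ℝ = -sphDirichlet (polyFun N p) f := by
  rw [polyClass_apply, inner_toL2,
    ← integral_rotLap_mul ((contDiff_polyFun p).of_le (by norm_cast)) hf]
  simp_rw [polySph_apply, hc, rotLap_polyFun]

lemma inner_polySphLap (p q : MvPolynomial (Fin N) ℝ) :
    ⟪polyClass N (polySphLap N p), polyClass N q⟫_ℝ = -sphDirichlet (polyFun N p) (polyFun N q) :=
  inner_polySphLap_toL2 p ((contDiff_polyFun q).of_le (by norm_cast)) (polySph_apply q)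

lemma inner_polySphLap_comm (p q : MvPolynomial (Fin N) ℝ) :
    ⟪polyClass N (polySphLap N p), polyClass N q⟫_ℝ
      = ⟪polyClass N p, polyClass N (polySphLap N q)⟫_ℝ := by
  rw [inner_polySphLap, real_inner_comm, inner_polySphLap, sphDirichlet_comm]

lemma polySphLap_eq_of_mem_orthogonal {m : ℕ} {p : MvPolynomial (Fin N) ℝ}
    (hp : p ∈ restrictTotalDegree (Fin N) ℝ (m + 1)) (horth : polyClass N p ∈ (polyL2 N m)ᗮ) :
    polyClass N (polySphLap N p) = -(sphEig N (m + 1) • polyClass N p) := by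
  obtain ⟨q, hq⟩ : ∃ q, q = polySphLap N p + sphEig N (m + 1) • p := ⟨_, rfl⟩
  have hqm : q ∈ restrictTotalDegree (Fin N) ℝ m := hq ▸ polySphLap_add_smul_mem hp
  have hclass : polyClass N q
      = polyClass N (polySphLap N p) + sphEig N (m + 1) • polyClass N p := by
    rw [hq, map_add, map_smul]
  have hp_orth {r : MvPolynomial (Fin N) ℝ} (hr : r ∈ restrictTotalDegree (Fin N) ℝ m) :
      ⟪polyClass N p, polyClass N r⟫_ℝ = 0 :=
    Submodule.inner_left_of_mem_orthogonal (polyClass_mem hr) horth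
  have hself : ⟪polyClass N (polySphLap N p) + sphEig N (m + 1) • polyClass N p,
      polyClass N q⟫_ℝ = 0 := by
    rw [inner_add_left, real_inner_smul_left, inner_polySphLap_comm, hp_orth hqm,
      hp_orth (polySphLap_mem hqm), mul_zero, add_zero]
  rw [← add_eq_zero_iff_eq_neg]
  rw [hclass] at hself
  exact inner_self_eq_zero.1 hself

lemma sphEig_mono (hN : 2 ≤ N) : Monotone (sphEig N) := fun i j hij => by
  have hij' : (i : ℝ) ≤ j := by exact_mod_cast hij
  have hN' : (2 : ℝ) ≤ N := by exact_mod_cast hN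
  unfold sphEig
  gcongr
  linarith [(Nat.cast_nonneg i : (0 : ℝ) ≤ i)]

lemma sphDirichlet_polyFun_add {k : ℕ} {q h : MvPolynomial (Fin N) ℝ}
    (hq : q ∈ restrictTotalDegree (Fin N) ℝ k) (hh : h ∈ restrictTotalDegree (Fin N) ℝ (k + 1))
    (horth : polyClass N h ∈ (polyL2 N k)ᗮ) :
    sphDirichlet (polyFun N (q + h)) (polyFun N (q + h))
      = sphDirichlet (polyFun N q) (polyFun N q) + sphEig N (k + 1) * ‖polyClass N h‖ ^ 2 := by
  have hinner {r : MvPolynomial (Fin N) ℝ} (hr : r ∈ restrictTotalDegree (Fin N) ℝ k) :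
      ⟪polyClass N r, polyClass N h⟫_ℝ = 0 := horth _ (polyClass_mem hr)
  rw [← neg_inj, neg_add, ← inner_polySphLap, ← inner_polySphLap, map_add, map_add, map_add,
    polySphLap_eq_of_mem_orthogonal hh horth, inner_add_left, inner_add_right, inner_add_right,
    hinner (polySphLap_mem hq), inner_neg_left, inner_neg_left, real_inner_smul_left,
    real_inner_smul_left, real_inner_comm (polyClass N q) (polyClass N h), hinner hq,
    real_inner_self_eq_norm_sq]
  ring

lemma sphEig_mul_le_sphDirichlet_polyFun (hN : 2 ≤ N) {m k : ℕ} (hmk : m ≤ k) :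
    ∀ p ∈ restrictTotalDegree (Fin N) ℝ k,
      sphEig N (m + 1) * (‖polyClass N p‖ ^ 2 - ‖(polyL2 N m).starProjection (polyClass N p)‖ ^ 2)
        ≤ sphDirichlet (polyFun N p) (polyFun N p) := by
  induction k, hmk using Nat.le_induction with
  | base =>
    intro p hp
    rw [Submodule.starProjection_eq_self_iff.2 (polyClass_mem hp), sub_self, mul_zero]
    exact sphDirichlet_self_nonneg _
  | succ k hmk ih =>
    intro p hp
    obtain ⟨q, hq, hqp⟩ := exists_polyClass_eq_starProjection k (polyClass N p)
    obtain ⟨h, rfl⟩ : ∃ h, p = q + h := ⟨p - q, by ring⟩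
    have hh : h ∈ restrictTotalDegree (Fin N) ℝ (k + 1) := by
      rw [mem_restrictTotalDegree] at hp hq ⊢
      rw [← add_sub_cancel_left q h]
      exact (totalDegree_sub _ q).trans (max_le hp (hq.trans k.le_succ))
    have horth : polyClass N h ∈ (polyL2 N k)ᗮ := by
      rw [← add_sub_cancel_left q h, map_sub, hqp]
      exact Submodule.sub_starProjection_mem_orthogonal _
    have hproj : (polyL2 N m).starProjection (polyClass N h) = 0 :=
      (Submodule.starProjection_apply_eq_zero_iff _).2
        (Submodule.orthogonal_le (polyL2_mono N hmk) horth)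
    rw [sphDirichlet_polyFun_add hq hh horth, map_add, map_add, hproj, add_zero, norm_add_sq_real,
      horth _ (polyClass_mem hq)]
    linarith [ih q hq, mul_le_mul_of_nonneg_right (sphEig_mono hN (Nat.succ_le_succ hmk))
      (sq_nonneg ‖polyClass N h‖)]

lemma dense_iSup_polyL2 (N : ℕ) : ⊤ ≤ (⨆ m, polyL2 N m).topologicalClosure := by
  have hsep : (polySph N).range.SeparatesPoints := by
    intro θ θ' hne
    obtain ⟨i, hi⟩ : ∃ i, (θ : E N) i ≠ (θ' : E N) i := by
      by_contra! h
      exact hne (Subtype.ext (PiLp.ext h))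
    exact ⟨_, ⟨_, ⟨X i, rfl⟩, rfl⟩, by simpa [polySph_apply, coe_polyFun_X] using hi⟩
  have hpoly : Dense ((polySph N).range : Set C(Sph N, ℝ)) := by
    rw [dense_iff_closure_eq, ← Subalgebra.topologicalClosure_coe,
      ContinuousMap.subalgebra_topologicalClosure_eq_top_of_separatesPoints _ hsep]
    rfl
  have hdense : Dense (toL2 N '' (polySph N).range) :=
    (ContinuousMap.toLp_denseRange ℝ (sphMeas N) ℝ (by norm_num)).dense_image
      (toL2 N).continuous hpoly
  refine fun x _ => closure_mono ?_ (hdense x)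
  rintro _ ⟨_, ⟨p, rfl⟩, rfl⟩
  exact Submodule.mem_iSup_of_mem p.totalDegree
    (polyClass_mem ((mem_restrictTotalDegree _ _ _).2 le_rfl))

/- For the polynomial `p` representing the projection of `f`, the cross term in
`0 ≤ D(f - p, f - p)` is `2 D(p, f) = 2 D(p, p)` because `polySphLap p` has the degree of `p`. -/
lemma sphDirichlet_polyFun_le {k : ℕ} {f : E N → ℝ} (hf : ContDiff ℝ 1 f)
    {c : C(Sph N, ℝ)} (hc : ∀ θ : Sph N, c θ = f θ) {p : MvPolynomial (Fin N) ℝ}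
    (hp : p ∈ restrictTotalDegree (Fin N) ℝ k)
    (hproj : polyClass N p = (polyL2 N k).starProjection (toL2 N c)) :
    sphDirichlet (polyFun N p) (polyFun N p) ≤ sphDirichlet f f := by
  have hcross : sphDirichlet (polyFun N p) f = sphDirichlet (polyFun N p) (polyFun N p) := by
    rw [← neg_inj, ← inner_polySphLap_toL2 p hf hc, ← inner_polySphLap, ← sub_eq_zero,
      ← inner_sub_right, hproj]
    exact Submodule.sub_starProjection_mem_orthogonal _ _ (polyClass_mem (polySphLap_mem hp))
  have hnonneg := sphDirichlet_self_nonneg fun x => f x - polyFun N p x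
  rw [sphDirichlet_sub_self hf ((contDiff_polyFun p).of_le (by norm_cast)), hcross] at hnonneg
  linarith

lemma sphEig_mul_le_sphDirichlet (hN : 2 ≤ N) (m : ℕ) {f : E N → ℝ} (hf : ContDiff ℝ 1 f)
    {c : C(Sph N, ℝ)} (hc : ∀ θ : Sph N, c θ = f θ) :
    sphEig N (m + 1) * (‖toL2 N c‖ ^ 2 - ‖(polyL2 N m).starProjection (toL2 N c)‖ ^ 2)
      ≤ sphDirichlet f f := by
  have hle {k : ℕ} (hmk : m ≤ k) : sphEig N (m + 1) * (‖(polyL2 N k).starProjection (toL2 N c)‖ ^ 2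
      - ‖(polyL2 N m).starProjection (toL2 N c)‖ ^ 2) ≤ sphDirichlet f f := by
    obtain ⟨p, hp, hproj⟩ := exists_polyClass_eq_starProjection k (toL2 N c)
    have hgap := sphEig_mul_le_sphDirichlet_polyFun hN hmk p hp
    have hcomp := DFunLike.congr_fun
      (Submodule.starProjection_comp_starProjection_of_le (polyL2_mono N hmk)) (toL2 N c)
    rw [hproj] at hgap
    rw [← hcomp]
    exact hgap.trans (sphDirichlet_polyFun_le hf hc hp hproj)
  have hlim := Submodule.starProjection_tendsto_self (polyL2 N) (polyL2_mono N) (toL2 N c)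
    (dense_iSup_polyL2 N)
  exact le_of_tendsto (((hlim.norm.pow 2).sub_const _).const_mul _)
    ((eventually_ge_atTop m).mono fun _ => hle)

end SpectralGap

section Symmetry
variable {N : ℕ}
open MvPolynomial

/-- The substitution `p ↦ p ∘ g` on polynomials. -/
noncomputable def polyComp (g : E N ≃ₗᵢ[ℝ] E N) :
    MvPolynomial (Fin N) ℝ →ₐ[ℝ] MvPolynomial (Fin N) ℝ :=
  aeval fun i => ∑ j, C (g (EuclideanSpace.single j 1) i) * X j

lemma polyFun_polyComp (g : E N ≃ₗᵢ[ℝ] E N) (p : MvPolynomial (Fin N) ℝ) (x : E N) :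
    polyFun N (polyComp g p) x = polyFun N p (g x) := by
  have hcoord (i : Fin N) : ∑ j, g (EuclideanSpace.single j 1) i * x j = g x i := by
    have hx : x = ∑ j, x j • EuclideanSpace.single j (1 : ℝ) := by
      ext i; simp [Pi.single_apply]
    conv_rhs => rw [hx, map_sum]
    simp [mul_comm]
  induction p using MvPolynomial.induction_on with
  | C a => simp [polyComp]
  | add p q hp hq => simp [hp, hq]
  | mul_X p i hp =>
    rw [map_mul, map_mul, map_mul, ContinuousMap.mul_apply, ContinuousMap.mul_apply, hp]
    simp [polyComp, coe_polyFun_X, hcoord]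

lemma polyComp_mem (g : E N ≃ₗᵢ[ℝ] E N) {m : ℕ} {p : MvPolynomial (Fin N) ℝ}
    (hp : p ∈ restrictTotalDegree (Fin N) ℝ m) :
    polyComp g p ∈ restrictTotalDegree (Fin N) ℝ m := by
  have hhom (i : Fin N) : (∑ j, C (g (EuclideanSpace.single j 1) i) * X j).IsHomogeneous 1 :=
    IsHomogeneous.sum _ _ _ fun j _ => isHomogeneous_C_mul_X _ j
  rw [mem_restrictTotalDegree] at hp
  rw [← sum_homogeneousComponent p, map_sum]
  refine sum_mem fun d hd => (mem_restrictTotalDegree _ _ _).2 ?_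
  have hdeg := ((homogeneousComponent_isHomogeneous d p).aeval _ hhom).totalDegree_le
  rw [one_mul] at hdeg
  exact hdeg.trans ((Finset.mem_range_succ_iff.1 hd).trans hp)

/-- The unitary operator `f ↦ f ∘ g` of `L²(𝕊^{N-1})`. -/
noncomputable def rotL2 (g : E N ≃ₗᵢ[ℝ] E N) : Lp ℝ 2 (sphMeas N) →ₗᵢ[ℝ] Lp ℝ 2 (sphMeas N) :=
  Lp.compMeasurePreservingₗᵢ ℝ (sphAct g) (measurePreserving_sphAct g)

lemma rotL2_polyClass (g : E N ≃ₗᵢ[ℝ] E N) (p : MvPolynomial (Fin N) ℝ) :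
    rotL2 g (polyClass N p) = polyClass N (polyComp g p) := by
  refine Lp.ext ?_
  filter_upwards [Lp.coeFn_compMeasurePreserving (polyClass N p) (measurePreserving_sphAct g),
    (measurePreserving_sphAct g).quasiMeasurePreserving.ae (coeFn_toL2 (polySph N p)),
    coeFn_toL2 (polySph N (polyComp g p))]
    with θ hcomp hp hpg
  exact hcomp.trans (hp.trans ((polyFun_polyComp g p θ).symm.trans hpg.symm))

lemma map_rotL2_polyL2 (g : E N ≃ₗᵢ[ℝ] E N) (m : ℕ) :
    (polyL2 N m).map (rotL2 g).toLinearMap = polyL2 N m := by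
  refine le_antisymm ?_ ?_
  · rintro _ ⟨_, ⟨p, hp, rfl⟩, rfl⟩
    exact (rotL2_polyClass g p).symm ▸ polyClass_mem (polyComp_mem g hp)
  · rintro _ ⟨p, hp, rfl⟩
    refine ⟨_, polyClass_mem (polyComp_mem g.symm hp), (rotL2_polyClass g _).trans ?_⟩
    rw [polyClass_eq_iff]
    intro θ
    rw [polyFun_polyComp, polyFun_polyComp, g.symm_apply_apply]

lemma rotL2_starProjection (g : E N ≃ₗᵢ[ℝ] E N) (m : ℕ) (x : Lp ℝ 2 (sphMeas N)) :
    rotL2 g ((polyL2 N m).starProjection x) = (polyL2 N m).starProjection (rotL2 g x) := by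
  refine (Submodule.eq_starProjection_of_mem_of_inner_eq_zero ?_ fun y hy => ?_).symm
  · exact (map_rotL2_polyL2 g m).le
      (Submodule.mem_map_of_mem (Submodule.starProjection_apply_mem _ x))
  · rw [← map_rotL2_polyL2 g m] at hy
    obtain ⟨z, hz, rfl⟩ := hy
    rw [← map_sub]
    exact ((rotL2 g).inner_map_map _ z).trans (Submodule.starProjection_inner_eq_zero x z hz)

lemma eq_zero_of_symEigenspace_eq_bot {G : Subgroup (E N ≃ₗᵢ[ℝ] E N)} {m : ℕ}
    (hG : symEigenspace G (sphEig N (m + 1)) = ⊥) {y : Lp ℝ 2 (sphMeas N)}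
    (hy : y ∈ polyL2 N (m + 1)) (horth : y ∈ (polyL2 N m)ᗮ) (hinv : ∀ g ∈ G, rotL2 g y = y) :
    y = 0 := by
  obtain ⟨p, hp, rfl⟩ := hy
  have hmem : (fun θ : Sph N => polyFun N p θ) ∈ symEigenspace G (sphEig N (m + 1)) := by
    refine ⟨smoothSph_coe (contDiff_polyFun p), fun θ => ?_, fun g hg θ => ?_⟩
    · have hclass : polyClass N (polySphLap N p) = polyClass N (-(sphEig N (m + 1) • p)) := by
        rw [polySphLap_eq_of_mem_orthogonal hp horth, map_neg, map_smul]
      rw [sphLap_coe (contDiff_polyFun p), rotLap_polyFun, polyClass_eq_iff.1 hclass]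
      simp
    · have hclass := hinv g hg
      rw [rotL2_polyClass] at hclass
      exact (polyFun_polyComp g p θ).symm.trans (polyClass_eq_iff.1 hclass θ)
  rw [hG, Submodule.mem_bot] at hmem
  rw [← map_zero (polyClass N), polyClass_eq_iff]
  exact fun θ => (congrFun hmem θ).trans (by simp)

lemma mem_polyL2_zero_of_invariant {G : Subgroup (E N ≃ₗᵢ[ℝ] E N)} {m : ℕ}
    (hG : ∀ i, 1 ≤ i → i ≤ m → symEigenspace G (sphEig N i) = ⊥) {y : Lp ℝ 2 (sphMeas N)}
    (hy : y ∈ polyL2 N m) (hinv : ∀ g ∈ G, rotL2 g y = y) : y ∈ polyL2 N 0 := by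
  induction m with
  | zero => exact hy
  | succ m ih =>
    refine ih (fun i hi him => hG i hi (him.trans m.le_succ)) ?_
    rw [← Submodule.starProjection_eq_self_iff, eq_comm, ← sub_eq_zero]
    refine eq_zero_of_symEigenspace_eq_bot (hG (m + 1) (by omega) le_rfl)
      (sub_mem hy (polyL2_mono N m.le_succ (Submodule.starProjection_apply_mem _ y)))
      (Submodule.sub_starProjection_mem_orthogonal y) fun g hg => ?_
    rw [map_sub, rotL2_starProjection, hinv g hg]

lemma exists_riesz_representer {ℓ : MvPolynomial (Fin N) ℝ →ₗ[ℝ] ℝ}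
    (hℓ : (polyClass N).ker ≤ ℓ.ker) (m : ℕ) :
    ∃ y ∈ polyL2 N m, ∀ p ∈ restrictTotalDegree (Fin N) ℝ m, ℓ p = ⟪y, polyClass N p⟫_ℝ := by
  obtain ⟨ℓ', rfl⟩ : ℓ ∈ (polyClass N).dualMap.range := by
    rw [LinearMap.range_dualMap_eq_dualAnnihilator_ker, Submodule.mem_dualAnnihilator]
    exact fun p hp => hℓ hp
  let y := (InnerProductSpace.toDual ℝ (polyL2 N m)).symm
    (LinearMap.toContinuousLinearMap (ℓ' ∘ₗ (polyL2 N m).subtype))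
  refine ⟨y, y.2, fun p hp => ?_⟩
  have hy := InnerProductSpace.toDual_symm_apply (x := ⟨polyClass N p, polyClass_mem hp⟩)
    (y := LinearMap.toContinuousLinearMap (ℓ' ∘ₗ (polyL2 N m).subtype))
  exact hy.symm

/- The Riesz representer `y` of `ℓ` is invariant, because
`⟪y, y ∘ g⟫ = ℓ (y ∘ g) = ℓ y = ‖y‖ ‖y ∘ g‖`; hence it is constant. -/
lemma invariant_functional_eq_zero {G : Subgroup (E N ≃ₗᵢ[ℝ] E N)} {m : ℕ}
    (hG : ∀ i, 1 ≤ i → i ≤ m → symEigenspace G (sphEig N i) = ⊥)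
    {ℓ : MvPolynomial (Fin N) ℝ →ₗ[ℝ] ℝ} (hℓ : (polyClass N).ker ≤ ℓ.ker)
    (hinv : ∀ g ∈ G, ∀ p, ℓ (polyComp g p) = ℓ p) {p : MvPolynomial (Fin N) ℝ}
    (hp : p ∈ restrictTotalDegree (Fin N) ℝ m) (horth : polyClass N p ∈ (polyL2 N 0)ᗮ) :
    ℓ p = 0 := by
  obtain ⟨_, ⟨q, hq, rfl⟩, hrep⟩ := exists_riesz_representer hℓ m
  have hrot (g) (hg : g ∈ G) : rotL2 g (polyClass N q) = polyClass N q := by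
    have hinner : ⟪polyClass N q, polyClass N (polyComp g q)⟫_ℝ = ‖polyClass N q‖ ^ 2 := by
      rw [← hrep _ (polyComp_mem g hq), hinv g hg, hrep q hq, real_inner_self_eq_norm_sq]
    rw [← sub_eq_zero, ← norm_eq_zero, ← sq_eq_zero_iff, norm_sub_sq_real, real_inner_comm,
      (rotL2 g).norm_map, rotL2_polyClass, hinner]
    ring
  rw [hrep p hp]
  exact horth _ (mem_polyL2_zero_of_invariant hG (polyClass_mem hq) hrot)

lemma exists_bound_polyFun_dir (p : MvPolynomial (Fin N) ℝ) :
    ∃ B, ∀ x : E N, ‖polyFun N p (‖x‖⁻¹ • x)‖ ≤ B := by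
  obtain ⟨B, hB⟩ := (isCompact_closedBall (0 : E N) 1).exists_bound_of_continuousOn
    (polyFun N p).continuous.continuousOn
  refine ⟨B, fun x => hB _ ?_⟩
  rw [mem_closedBall_zero_iff, norm_smul, norm_inv, norm_norm]
  exact inv_mul_le_one

lemma integral_mul_polyFun_dir_eq_zero {G : Subgroup (E N ≃ₗᵢ[ℝ] E N)} {m : ℕ}
    (hG : ∀ i, 1 ≤ i → i ≤ m → symEigenspace G (sphEig N i) = ⊥)
    {ν : Measure (E N)} (hν : ∀ g ∈ G, MeasurePreserving g ν ν) (hν0 : ∀ᵐ x ∂ν, x ≠ 0)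
    {χ : E N → ℝ} (hχ : Integrable χ ν) (hinv : ∀ g ∈ G, ∀ᵐ x ∂ν, χ (g x) = χ x)
    {p : MvPolynomial (Fin N) ℝ} (hp : p ∈ restrictTotalDegree (Fin N) ℝ m)
    (horth : polyClass N p ∈ (polyL2 N 0)ᗮ) :
    ∫ x, χ x * polyFun N p (‖x‖⁻¹ • x) ∂ν = 0 := by
  have hint (q : MvPolynomial (Fin N) ℝ) :
      Integrable (fun x => χ x * polyFun N q (‖x‖⁻¹ • x)) ν := by
    obtain ⟨B, hB⟩ := exists_bound_polyFun_dir q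
    exact hχ.mul_bdd ((polyFun N q).continuous.measurable.comp (by fun_prop)).aestronglyMeasurable
      (Eventually.of_forall hB)
  let ℓ : MvPolynomial (Fin N) ℝ →ₗ[ℝ] ℝ :=
    { toFun := fun q => ∫ x, χ x * polyFun N q (‖x‖⁻¹ • x) ∂ν
      map_add' := fun q r => by
        rw [← integral_add (hint q) (hint r)]
        simp_rw [map_add, ContinuousMap.add_apply, mul_add]
      map_smul' := fun c q => by
        rw [RingHom.id_apply, smul_eq_mul, ← integral_const_mul]
        simp_rw [map_smul, ContinuousMap.smul_apply, smul_eq_mul, mul_left_comm] }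
  refine invariant_functional_eq_zero hG (ℓ := ℓ) (fun q hq => ?_) (fun g hg q => ?_) hp horth
  · have hzero := polyClass_eq_iff.1 (hq.trans (map_zero (polyClass N)).symm)
    refine integral_eq_zero_of_ae ?_
    filter_upwards [hν0] with x hx
    have hdir := hzero ⟨‖x‖⁻¹ • x, by simp [norm_smul, hx]⟩
    simp_all
  · change ∫ x, χ x * polyFun N (polyComp g q) (‖x‖⁻¹ • x) ∂ν
      = ∫ x, χ x * polyFun N q (‖x‖⁻¹ • x) ∂ν
    rw [← (hν g hg).integral_comp g.toHomeomorph.measurableEmbedding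
      (fun x => χ x * polyFun N q (‖x‖⁻¹ • x))]
    refine integral_congr_ae ?_
    filter_upwards [hinv g hg] with x hx
    rw [hx, polyFun_polyComp, map_smul, g.norm_map]

end Symmetry

lemma comp_homeomorphUnitSphereProd {V β : Type*} [NormedAddCommGroup V] [NormedSpace ℝ V]
    (f : V → β) :
    (fun z : sphere (0 : V) 1 × Set.Ioi (0 : ℝ) => f (z.2.1 • z.1.1)) ∘ homeomorphUnitSphereProd V
      = f ∘ Subtype.val :=
  funext fun x => congrArg (f ∘ Subtype.val) ((homeomorphUnitSphereProd V).symm_apply_apply x)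

section Polar
open Module
variable {V F : Type*} [NormedAddCommGroup V] [NormedSpace ℝ V] [FiniteDimensional ℝ V]
  [MeasurableSpace V] [BorelSpace V] [NormedAddCommGroup F] (μ : Measure V) [μ.IsAddHaarMeasure]

lemma integrable_sphere_prod {f : V → F} (hf : Integrable f μ) :
    Integrable (fun z : sphere (0 : V) 1 × Set.Ioi (0 : ℝ) => f (z.2.1 • z.1.1))
      (μ.toSphere.prod (Measure.volumeIoiPow (finrank ℝ V - 1))) := by
  rw [← μ.measurePreserving_homeomorphUnitSphereProd.integrable_comp_emb
    (homeomorphUnitSphereProd V).measurableEmbedding, comp_homeomorphUnitSphereProd,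
    ← integrableOn_iff_comap_subtypeVal (measurableSet_singleton _).compl]
  exact hf.integrableOn

variable [Nontrivial V] [NormedSpace ℝ F]

lemma integral_eq_integral_sphere_prod (f : V → F) :
    ∫ x, f x ∂μ = ∫ z : sphere (0 : V) 1 × Set.Ioi (0 : ℝ), f (z.2.1 • z.1.1)
      ∂(μ.toSphere.prod (Measure.volumeIoiPow (finrank ℝ V - 1))) := by
  rw [← μ.measurePreserving_homeomorphUnitSphereProd.integral_comp
    (homeomorphUnitSphereProd V).measurableEmbedding]
  calc ∫ x, f x ∂μ
      = ∫ x : ({0}ᶜ : Set V), f x ∂(μ.comap Subtype.val) := by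
        rw [integral_subtype_comap (measurableSet_singleton _).compl, restrict_compl_singleton]
    _ = _ := congrArg (fun h => ∫ x, h x ∂(μ.comap Subtype.val))
        (comp_homeomorphUnitSphereProd f).symm

lemma integral_eq_integral_Ioi_toSphere {f : V → F} (hf : Integrable f μ) :
    ∫ x, f x ∂μ = ∫ r in Set.Ioi (0 : ℝ),
      r ^ (finrank ℝ V - 1) • ∫ θ : sphere (0 : V) 1, f (r • θ.1) ∂μ.toSphere := by
  rw [integral_eq_integral_sphere_prod, integral_prod_symm _ (integrable_sphere_prod μ hf)]
  simp only [Measure.volumeIoiPow, ENNReal.ofReal]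
  rw [integral_withDensity_eq_integral_smul
      (measurable_subtype_coe.pow_const (finrank ℝ V - 1)).real_toNNReal,
    integral_subtype_comap measurableSet_Ioi
      fun r => Real.toNNReal (r ^ (finrank ℝ V - 1)) • ∫ θ, f (r • θ.1) ∂μ.toSphere]
  refine setIntegral_congr_fun measurableSet_Ioi fun r hr => ?_
  rw [NNReal.smul_def, Real.coe_toNNReal _ (pow_nonneg (le_of_lt hr) _)]

end Polar

section HyperbolicVolume
variable {N : ℕ} {R : ℝ}

lemma norm_smul_sph {r : ℝ} (hr : 0 ≤ r) (θ : Sph N) : ‖r • (θ : E N)‖ = r := by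
  rw [norm_smul, mem_sphere_zero_iff_norm.1 θ.2, mul_one, Real.norm_of_nonneg hr]

lemma measurableSet_extBall (N : ℕ) (R : ℝ) : MeasurableSet (extBall N R) :=
  measurableSet_lt measurable_const measurable_norm

lemma measurable_hypDensity (N : ℕ) :
    Measurable fun x : E N => (Real.sinh ‖x‖ / ‖x‖) ^ (N - 1) := by
  have := Real.measurable_sinh
  fun_prop

lemma hypDensity_nonneg (x : E N) : 0 ≤ (Real.sinh ‖x‖ / ‖x‖) ^ (N - 1) :=
  pow_nonneg (div_nonneg (Real.sinh_nonneg_iff.2 (norm_nonneg x)) (norm_nonneg x)) _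

lemma integrableOn_hypVol_iff {F : E N → ℝ} :
    IntegrableOn F (extBall N R) (hypVol N)
      ↔ IntegrableOn (fun x => (Real.sinh ‖x‖ / ‖x‖) ^ (N - 1) * F x) (extBall N R) := by
  rw [IntegrableOn, hypVol, restrict_withDensity (measurableSet_extBall N R),
    integrable_withDensity_iff_integrable_smul' (measurable_hypDensity N).ennreal_ofReal
      (Eventually.of_forall fun _ => ENNReal.ofReal_lt_top)]
  simp_rw [ENNReal.toReal_ofReal (hypDensity_nonneg _), smul_eq_mul]
  rfl

lemma setIntegral_hypVol (F : E N → ℝ) :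
    ∫ x in extBall N R, F x ∂(hypVol N)
      = ∫ x in extBall N R, (Real.sinh ‖x‖ / ‖x‖) ^ (N - 1) * F x := by
  rw [hypVol, restrict_withDensity (measurableSet_extBall N R),
    integral_withDensity_eq_integral_toReal_smul (measurable_hypDensity N).ennreal_ofReal
      (Eventually.of_forall fun _ => ENNReal.ofReal_lt_top)]
  simp_rw [ENNReal.toReal_ofReal (hypDensity_nonneg _), smul_eq_mul]

lemma integrableOn_extBall_of_continuousOn {K : ℝ} (hR : 0 < R) {F : E N → ℝ}
    (hF : ContinuousOn F {0}ᶜ) (hK : ∀ x, K ≤ ‖x‖ → F x = 0) :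
    IntegrableOn F (extBall N R) (hypVol N) := by
  rw [integrableOn_hypVol_iff]
  set S : Set (E N) := closedBall 0 K ∩ {x | R ≤ ‖x‖}
  have hS : IsCompact S :=
    (isCompact_closedBall 0 K).inter_right (isClosed_le continuous_const continuous_norm)
  have hS0 : S ⊆ {0}ᶜ := fun x hx => norm_pos_iff.1 (hR.trans_le hx.2)
  have hc : ContinuousOn (fun x : E N => (Real.sinh ‖x‖ / ‖x‖) ^ (N - 1) * F x) S :=
    (((Real.continuous_sinh.comp continuous_norm).continuousOn.div continuous_norm.continuousOn
      fun x hx => norm_ne_zero_iff.2 (hS0 hx)).pow _).mul (hF.mono hS0)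
  refine IntegrableOn.of_forall_sdiff_eq_zero (hc.integrableOn_compact hS)
    (measurableSet_extBall N R) fun x hx => ?_
  have hKx : K ≤ ‖x‖ := by
    by_contra! hlt
    exact hx.2 ⟨mem_closedBall_zero_iff.2 hlt.le, (show R < ‖x‖ from hx.1).le⟩
  rw [hK x hKx, mul_zero]

lemma setIntegral_extBall_eq_integral_Ioi (hN : 1 ≤ N) (hR : 0 ≤ R) {F : E N → ℝ}
    (hF : IntegrableOn F (extBall N R) (hypVol N)) :
    ∫ x in extBall N R, F x ∂(hypVol N)
      = ∫ r in Set.Ioi R, Real.sinh r ^ (N - 1) * ∫ θ : Sph N, F (r • (θ : E N)) ∂(sphMeas N) := by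
  have : Nontrivial (E N) := Module.nontrivial_of_finrank_pos (R := ℝ) (by simp; omega)
  rw [integrableOn_hypVol_iff] at hF
  rw [setIntegral_hypVol, ← integral_indicator (measurableSet_extBall N R),
    integral_eq_integral_Ioi_toSphere _ (hF.integrable_indicator (measurableSet_extBall N R)),
    finrank_euclideanSpace_fin, ← Set.inter_eq_right.2 (Set.Ioi_subset_Ioi hR),
    ← setIntegral_indicator measurableSet_Ioi]
  refine setIntegral_congr_fun measurableSet_Ioi fun r (hr : 0 < r) => ?_
  have hnorm (θ : Sph N) := norm_smul_sph hr.le θ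
  by_cases hrR : R < r
  · have hmem (θ : Sph N) : r • (θ : E N) ∈ extBall N R := by simpa [extBall, hnorm θ] using hrR
    simp only [Set.indicator_of_mem (hmem _), hnorm, Set.indicator_of_mem (Set.mem_Ioi.2 hrR)]
    rw [integral_const_mul, smul_eq_mul, ← mul_assoc, ← mul_pow, mul_div_cancel₀ _ hr.ne']
    rfl
  · have hmem (θ : Sph N) : r • (θ : E N) ∉ extBall N R := by simpa [extBall, hnorm θ] using hrR
    simp only [Set.indicator_of_notMem (hmem _),
      Set.indicator_of_notMem (show r ∉ Set.Ioi R from hrR), integral_zero, smul_zero]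

lemma measurePreserving_hypVol (g : E N ≃ₗᵢ[ℝ] E N) :
    MeasurePreserving g (hypVol N) (hypVol N) := by
  have hemb : MeasurableEmbedding g := g.toHomeomorph.measurableEmbedding
  refine ⟨hemb.measurable, ?_⟩
  ext s hs
  rw [Measure.map_apply hemb.measurable hs, hypVol,
    withDensity_apply _ (hemb.measurable hs), withDensity_apply _ hs,
    ← g.measurePreserving.setLIntegral_comp_preimage_emb hemb
      (fun x => ENNReal.ofReal ((Real.sinh ‖x‖ / ‖x‖) ^ (N - 1))) s]
  simp only [g.norm_map]

lemma measurePreserving_hypVol_restrict (R : ℝ) (g : E N ≃ₗᵢ[ℝ] E N) :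
    MeasurePreserving g ((hypVol N).restrict (extBall N R))
      ((hypVol N).restrict (extBall N R)) := by
  have hpre : g ⁻¹' extBall N R = extBall N R := by ext x; simp [extBall]
  simpa only [hpre] using (measurePreserving_hypVol g).restrict_preimage_emb
    g.toHomeomorph.measurableEmbedding (extBall N R)

lemma ne_zero_of_mem_extBall (hR : 0 ≤ R) {x : E N} (hx : x ∈ extBall N R) : x ≠ 0 :=
  norm_pos_iff.1 (hR.trans_lt hx)

lemma ae_ne_zero_extBall (hR : 0 ≤ R) : ∀ᵐ x ∂((hypVol N).restrict (extBall N R)), x ≠ 0 :=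
  (ae_restrict_mem (measurableSet_extBall N R)).mono fun _ => ne_zero_of_mem_extBall hR

end HyperbolicVolume

lemma integrableOn_Ioi_of_continuousOn {R K : ℝ} {h : ℝ → ℝ} (hc : ContinuousOn h (Set.Ici R))
    (hK : ∀ r, K ≤ r → h r = 0) : IntegrableOn h (Set.Ioi R) := by
  have hIcc : IntegrableOn h (Set.Icc R K) :=
    (hc.mono Set.Icc_subset_Ici_self).integrableOn_compact isCompact_Icc
  refine IntegrableOn.of_forall_sdiff_eq_zero hIcc measurableSet_Ioi fun r hr => hK r ?_
  by_contra! hlt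
  exact hr.2 ⟨le_of_lt hr.1, hlt.le⟩

section Hardy
variable {H : Type*} [NormedAddCommGroup H] [InnerProductSpace ℝ H]

lemma neg_deriv_sinh_pow_mul_norm_sq_le (n : ℕ) {a r : ℝ} (ha : 0 ≤ a) (hr : 0 < r) (y y' : H) :
    -a * ((n * Real.sinh r ^ (n - 1) * Real.cosh r) * ‖y‖ ^ 2
        + Real.sinh r ^ n * (2 * ⟪y, y'⟫_ℝ))
      ≤ Real.sinh r ^ (n + 1) * (‖y'‖ ^ 2 + a * (a - n) / Real.sinh r ^ 2 * ‖y‖ ^ 2) := by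
  have hcosh : a * (n * Real.sinh r ^ (n - 1) * ‖y‖ ^ 2) * 1
      ≤ a * (n * Real.sinh r ^ (n - 1) * ‖y‖ ^ 2) * Real.cosh r :=
    mul_le_mul_of_nonneg_left (Real.one_le_cosh r) (by positivity)
  have hpow : (n : ℝ) * Real.sinh r ^ (n + 1) / Real.sinh r ^ 2 = n * Real.sinh r ^ (n - 1) := by
    rcases n with _ | k
    · simp
    · rw [Nat.add_sub_cancel]
      field_simp
      ring
  have hsq : 0 ≤ Real.sinh r ^ (n + 1) * ‖y' + (a / Real.sinh r) • y‖ ^ 2 := by positivity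
  rw [norm_add_sq_real, norm_smul, real_inner_smul_right, real_inner_comm, mul_pow,
    Real.norm_eq_abs, sq_abs] at hsq
  have hexpand : Real.sinh r ^ (n + 1) * (‖y'‖ ^ 2 + 2 * (a / Real.sinh r * ⟪y, y'⟫_ℝ)
        + (a / Real.sinh r) ^ 2 * ‖y‖ ^ 2)
      = Real.sinh r ^ (n + 1) * (‖y'‖ ^ 2 + a * (a - n) / Real.sinh r ^ 2 * ‖y‖ ^ 2)
        + a * (Real.sinh r ^ n * (2 * ⟪y, y'⟫_ℝ))
        + a * (n * Real.sinh r ^ (n + 1) / Real.sinh r ^ 2 * ‖y‖ ^ 2) := by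
    field_simp
    ring
  rw [hexpand, hpow] at hsq
  linarith

variable {R K : ℝ} {y y' : ℝ → H}

lemma deriv_eq_zero_of_vanishing (hy : ∀ r, HasDerivAt y (y' r) r) (hK : ∀ r, K ≤ r → y r = 0)
    {r : ℝ} (hr : K < r) : y' r = 0 :=
  (hy r).unique <| (hasDerivAt_const r (0 : H)).congr_of_eventuallyEq <|
    (eventually_gt_nhds hr).mono fun s hs => hK s hs.le

lemma integrableOn_sinh_pow_mul (k : ℕ) (b : ℝ) (hR : 0 < R) (hy : ∀ r, HasDerivAt y (y' r) r)
    (hy' : Continuous y') (hK : ∀ r, K ≤ r → y r = 0) :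
    IntegrableOn (fun r => Real.sinh r ^ k * (‖y' r‖ ^ 2 + b / Real.sinh r ^ 2 * ‖y r‖ ^ 2))
      (Set.Ioi R) := by
  have hyc : Continuous y := continuous_iff_continuousAt.2 fun r => (hy r).continuousAt
  have hsinh0 (r) (hr : r ∈ Set.Ici R) : Real.sinh r ^ 2 ≠ 0 :=
    pow_ne_zero _ (Real.sinh_pos_iff.2 (hR.trans_le hr)).ne'
  refine integrableOn_Ioi_of_continuousOn (K := K + 1) (by fun_prop (disch := assumption))
    fun r hr => ?_
  have hKr : K < r := (lt_add_one K).trans_le hr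
  simp [hK r hKr.le, deriv_eq_zero_of_vanishing hy hK hKr]

lemma sinh_hardy (n : ℕ) {a : ℝ} (ha : 0 ≤ a) (hR : 0 < R) (hy : ∀ r, HasDerivAt y (y' r) r)
    (hy' : Continuous y') (hK : ∀ r, K ≤ r → y r = 0) :
    a * (Real.sinh R ^ n * ‖y R‖ ^ 2) ≤ ∫ r in Set.Ioi R,
      Real.sinh r ^ (n + 1) * (‖y' r‖ ^ 2 + a * (a - n) / Real.sinh r ^ 2 * ‖y r‖ ^ 2) := by
  have hyc : Continuous y := continuous_iff_continuousAt.2 fun r => (hy r).continuousAt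
  let v' : ℝ → ℝ := fun r => (n * Real.sinh r ^ (n - 1) * Real.cosh r) * ‖y r‖ ^ 2
    + Real.sinh r ^ n * (2 * ⟪y r, y' r⟫_ℝ)
  have hv (r : ℝ) : HasDerivAt (fun r => Real.sinh r ^ n * ‖y r‖ ^ 2) (v' r) r :=
    ((Real.hasDerivAt_sinh r).pow n).mul (hy r).norm_sq
  have hv'_int : IntegrableOn v' (Set.Ioi R) :=
    integrableOn_Ioi_of_continuousOn (K := K) (by fun_prop) fun r hr => by simp [v', hK r hr]
  have hv'_integral : ∫ r in Set.Ioi R, v' r = 0 - Real.sinh R ^ n * ‖y R‖ ^ 2 := by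
    refine integral_Ioi_of_hasDerivAt_of_tendsto' (fun r _ => hv r) hv'_int ?_
    refine tendsto_const_nhds.congr' ?_
    filter_upwards [eventually_ge_atTop K] with r hr
    simp [hK r hr]
  calc a * (Real.sinh R ^ n * ‖y R‖ ^ 2) = ∫ r in Set.Ioi R, -a * v' r := by
        rw [integral_const_mul, hv'_integral]
        ring
    _ ≤ _ := setIntegral_mono_on (hv'_int.const_mul _)
        (integrableOn_sinh_pow_mul _ _ hR hy hy' hK) measurableSet_Ioi
        fun r hr => neg_deriv_sinh_pow_mul_norm_sq_le n ha (hR.trans hr) (y r) (y' r)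

end Hardy

section Slices
variable {N : ℕ} {φ : E N → ℝ}

/-- A function on `ℝ^N` in polar coordinates `(r, θ)`. -/
def polar (hφ : ContDiff ℝ 1 φ) : C(ℝ × Sph N, ℝ) where
  toFun z := φ (z.1 • (z.2 : E N))
  continuous_toFun := hφ.continuous.comp (by fun_prop)

/-- The radial derivative of a function on `ℝ^N` in polar coordinates `(r, θ)`. -/
noncomputable def polarDeriv (hφ : ContDiff ℝ 1 φ) : C(ℝ × Sph N, ℝ) where
  toFun z := fderiv ℝ φ (z.1 • (z.2 : E N)) z.2
  continuous_toFun :=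
    ((hφ.continuous_fderiv one_ne_zero).comp (by fun_prop)).clm_apply (by fun_prop)

/-- The restriction `θ ↦ φ (r θ)` of a function to the sphere of radius `r`, as an element of
`L²(𝕊^{N-1})`. -/
noncomputable def slice (hφ : ContDiff ℝ 1 φ) (r : ℝ) : Lp ℝ 2 (sphMeas N) :=
  toL2 N ((polar hφ).curry r)

/-- The restriction `θ ↦ ∂_r φ (r θ)` of the radial derivative to the sphere of radius `r`, as an
element of `L²(𝕊^{N-1})`. -/
noncomputable def sliceDeriv (hφ : ContDiff ℝ 1 φ) (r : ℝ) : Lp ℝ 2 (sphMeas N) :=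
  toL2 N ((polarDeriv hφ).curry r)

lemma hasDerivAt_slice (hφ : ContDiff ℝ 1 φ) (r : ℝ) :
    HasDerivAt (slice hφ) (sliceDeriv hφ r) r := by
  refine (toL2 N).hasFDerivAt.comp_hasDerivAt r (hasDerivAt_curry (F := polar hφ)
    (F' := polarDeriv hφ) (fun s θ => ?_) r)
  have hray : HasDerivAt (fun s : ℝ => s • (θ : E N)) (θ : E N) s := by
    simpa using (hasDerivAt_id s).smul_const (θ : E N)
  exact (hφ.differentiable one_ne_zero _).hasFDerivAt.comp_hasDerivAt s hray

lemma continuous_sliceDeriv (hφ : ContDiff ℝ 1 φ) : Continuous (sliceDeriv hφ) :=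
  (toL2 N).continuous.comp (polarDeriv hφ).curry.continuous

lemma continuous_slice (hφ : ContDiff ℝ 1 φ) : Continuous (slice hφ) :=
  (toL2 N).continuous.comp (polar hφ).curry.continuous

lemma norm_sliceDeriv_sq (hφ : ContDiff ℝ 1 φ) (r : ℝ) :
    ‖sliceDeriv hφ r‖ ^ 2 = ∫ θ : Sph N, fderiv ℝ φ (r • (θ : E N)) θ ^ 2 ∂(sphMeas N) :=
  norm_toL2_sq _

lemma slice_eq_zero (hφ : ContDiff ℝ 1 φ) {K r : ℝ} (hK : ∀ x, K ≤ ‖x‖ → φ x = 0) (hr : 0 ≤ r)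
    (hKr : K ≤ r) : slice hφ r = 0 := by
  have h : (polar hφ).curry r = 0 := by
    ext θ
    exact hK _ (by rwa [norm_smul_sph hr])
  rw [slice, h, map_zero]

lemma rotDeriv_comp_smul (i j : Fin N) (r : ℝ) (x : E N) :
    rotDeriv i j (fun x => φ (r • x)) x = rotDeriv i j φ (r • x) := by
  rw [rotDeriv, rotDeriv, fderiv_comp_smul, _root_.smul_apply, map_smul, map_smul]

lemma sphDirichlet_comp_smul (hφ : ContDiff ℝ 1 φ) (r : ℝ) :
    sphDirichlet (fun x => φ (r • x)) (fun x => φ (r • x))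
      = ∫ θ : Sph N, 1 / 2 * ∑ i, ∑ j, rotDeriv i j φ (r • (θ : E N)) ^ 2 ∂(sphMeas N) := by
  have hint (i j : Fin N) :
      Integrable (fun θ : Sph N => rotDeriv i j φ (r • (θ : E N)) ^ 2) (sphMeas N) :=
    integrable_sphMeas (((continuous_rotDeriv hφ i j).comp (by fun_prop)).pow 2)
  rw [integral_const_mul,
    integral_finsetSum _ fun i _ => integrable_finsetSum _ fun j _ => hint i j]
  simp_rw [integral_finsetSum _ fun j _ => hint _ j, sphDirichlet, rotDeriv_comp_smul, sq]

lemma continuous_sphDirichlet_comp_smul (hφ : ContDiff ℝ 1 φ) :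
    Continuous fun r : ℝ => sphDirichlet (fun x => φ (r • x)) (fun x => φ (r • x)) := by
  simp_rw [sphDirichlet_comp_smul hφ]
  refine (continuous_parametric_integral_of_continuous (f := fun (r : ℝ) (θ : Sph N) =>
    1 / 2 * ∑ i, ∑ j, rotDeriv i j φ (r • (θ : E N)) ^ 2) ?_ isCompact_univ).congr fun r =>
    by rw [Measure.restrict_univ]
  have := continuous_rotDeriv hφ
  simp only [Function.uncurry_def]
  fun_prop

lemma gradSq_gradient {x : E N} (hx : x ≠ 0) :
    gradSq x (gradient φ x) = fderiv ℝ φ x (‖x‖⁻¹ • x) ^ 2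
      + (1 / 2 * ∑ i, ∑ j, rotDeriv i j φ x ^ 2) / Real.sinh ‖x‖ ^ 2 := by
  have hx0 : ‖x‖ ≠ 0 := norm_ne_zero_iff.2 hx
  have hs : Real.sinh ‖x‖ ≠ 0 := (Real.sinh_pos_iff.2 (norm_pos_iff.2 hx)).ne'
  have hfderiv (v : E N) : fderiv ℝ φ x v = ⟪gradient φ x, v⟫_ℝ := (inner_gradient_left ..).symm
  have hrot : ∑ i, ∑ j, rotDeriv i j φ x ^ 2
      = 2 * (‖x‖ ^ 2 * ‖gradient φ x‖ ^ 2 - ⟪x, gradient φ x⟫_ℝ ^ 2) := by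
    have hsum := sum_bilin_rotGen ((innerSL ℝ (gradient φ x)).smulRight
      (innerSL ℝ (gradient φ x))) x x
    simp only [ContinuousLinearMap.smulRight_apply, _root_.smul_apply, innerSL_apply_apply,
      smul_eq_mul, EuclideanSpace.inner_single_right, one_mul, conj_trivial, ← sq,
      ← EuclideanSpace.real_norm_sq_eq, real_inner_self_eq_norm_sq] at hsum
    simp_rw [rotDeriv, hfderiv, hsum, real_inner_comm x (gradient φ x)]
  rw [hrot, gradSq_eq hx, hfderiv, real_inner_smul_right, real_inner_comm x (gradient φ x)]
  field_simp

lemma integral_gradSq_sph (hφ : ContDiff ℝ 1 φ) {r : ℝ} (hr : 0 < r) :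
    ∫ θ : Sph N, gradSq (r • (θ : E N)) (gradient φ (r • (θ : E N))) ∂(sphMeas N)
      = ‖sliceDeriv hφ r‖ ^ 2
        + sphDirichlet (fun x => φ (r • x)) (fun x => φ (r • x)) / Real.sinh r ^ 2 := by
  have hgradSq (θ : Sph N) : gradSq (r • (θ : E N)) (gradient φ (r • (θ : E N)))
      = fderiv ℝ φ (r • (θ : E N)) θ ^ 2
        + (1 / 2 * ∑ i, ∑ j, rotDeriv i j φ (r • (θ : E N)) ^ 2) / Real.sinh r ^ 2 := by
    have hne : r • (θ : E N) ≠ 0 := norm_pos_iff.1 (by rwa [norm_smul_sph hr.le])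
    rw [gradSq_gradient hne, norm_smul_sph hr.le, smul_smul, inv_mul_cancel₀ hr.ne', one_smul]
  have hrot := continuous_rotDeriv hφ
  have hradial : Integrable (fun θ : Sph N => fderiv ℝ φ (r • (θ : E N)) θ ^ 2) (sphMeas N) :=
    integrable_sphMeas (((polarDeriv hφ).curry r).continuous.pow 2)
  have hangular : Integrable (fun θ : Sph N =>
      (1 / 2 * ∑ i, ∑ j, rotDeriv i j φ (r • (θ : E N)) ^ 2) / Real.sinh r ^ 2) (sphMeas N) :=
    integrable_sphMeas (by fun_prop)
  simp_rw [hgradSq]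
  rw [integral_add hradial hangular, integral_div, sphDirichlet_comp_smul hφ, norm_sliceDeriv_sq]

end Slices

section GradSq
variable {N : ℕ} {R : ℝ}

lemma gradSq_zero (x : E N) : gradSq x 0 = 0 := by
  simp [gradSq, hypGrad, hypMetric]

lemma gradSq_neg {x : E N} (hx : x ≠ 0) (ξ : E N) : gradSq x (-ξ) = gradSq x ξ := by
  rw [gradSq_eq hx, gradSq_eq hx, inner_neg_right, norm_neg, neg_div, neg_sq]

lemma gradSq_nonneg {x : E N} (hx : x ≠ 0) (ξ : E N) : 0 ≤ gradSq x ξ := by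
  have hradial : (⟪x, ξ⟫_ℝ / ‖x‖) ^ 2 ≤ ‖ξ‖ ^ 2 := by
    rw [div_pow, div_le_iff₀ (by positivity), ← sq_abs, ← mul_pow]
    exact pow_le_pow_left₀ (abs_nonneg _) ((abs_real_inner_le_norm x ξ).trans_eq (mul_comm _ _)) 2
  rw [gradSq_eq hx]
  exact add_nonneg (sq_nonneg _) (mul_nonneg (sq_nonneg _) (sub_nonneg.2 hradial))

lemma gradSq_add_le {x : E N} (hx : x ≠ 0) {ε : ℝ} (hε : 0 < ε) (ξ η : E N) :
    gradSq x (ξ + η) ≤ (1 + ε) * gradSq x ξ + (1 + 1 / ε) * gradSq x η := by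
  have hdiff : (1 + ε) * gradSq x ξ + (1 + 1 / ε) * gradSq x η - gradSq x (ξ + η)
      = gradSq x (ε • ξ - η) / ε := by
    simp only [gradSq_eq hx, norm_add_sq_real, norm_sub_sq_real, inner_add_right, inner_sub_right,
      real_inner_smul_right, real_inner_smul_left, norm_smul, mul_pow, Real.norm_eq_abs, sq_abs]
    field_simp
    ring
  linarith [div_nonneg (gradSq_nonneg hx (ε • ξ - η)) hε.le]

lemma measurable_gradSq : Measurable fun z : E N × E N => gradSq z.1 z.2 := by
  have := Real.measurable_sinh
  unfold gradSq hypMetric hypGrad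
  fun_prop

variable {Φ Ψ : E N → E N}

lemma integrableOn_gradSq_sub (hR : 0 ≤ R)
    (hΦ : AEStronglyMeasurable Φ ((hypVol N).restrict (extBall N R)))
    (hΨ : AEStronglyMeasurable Ψ ((hypVol N).restrict (extBall N R)))
    (hΦ_int : IntegrableOn (fun x => gradSq x (Φ x)) (extBall N R) (hypVol N))
    (hΨ_int : IntegrableOn (fun x => gradSq x (Ψ x)) (extBall N R) (hypVol N)) :
    IntegrableOn (fun x => gradSq x (Φ x - Ψ x)) (extBall N R) (hypVol N) := by
  refine Integrable.mono' ((hΦ_int.const_mul 2).add (hΨ_int.const_mul 2)) ?_ ?_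
  · exact (measurable_gradSq.comp_aemeasurable
      (measurable_id.aemeasurable.prodMk (hΦ.sub hΨ).aemeasurable)).aestronglyMeasurable
  · filter_upwards [ae_ne_zero_extBall hR] with x hx
    have h := gradSq_add_le hx one_pos (Φ x) (-Ψ x)
    rw [gradSq_neg hx, ← sub_eq_add_neg] at h
    rw [Real.norm_of_nonneg (gradSq_nonneg hx _)]
    norm_num at h
    exact h

lemma integral_gradSq_le (hR : 0 ≤ R)
    (hΦ : IntegrableOn (fun x => gradSq x (Φ x)) (extBall N R) (hypVol N))
    (hΨ : IntegrableOn (fun x => gradSq x (Ψ x)) (extBall N R) (hypVol N))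
    (hΦΨ : IntegrableOn (fun x => gradSq x (Φ x - Ψ x)) (extBall N R) (hypVol N))
    {ε : ℝ} (hε : 0 < ε) :
    ∫ x in extBall N R, gradSq x (Φ x) ∂(hypVol N)
      ≤ (1 + ε) * ∫ x in extBall N R, gradSq x (Ψ x) ∂(hypVol N)
        + (1 + 1 / ε) * ∫ x in extBall N R, gradSq x (Φ x - Ψ x) ∂(hypVol N) := by
  rw [← integral_const_mul, ← integral_const_mul,
    ← integral_add (hΨ.const_mul _) (hΦΨ.const_mul _)]
  refine integral_mono_ae hΦ ((hΨ.const_mul _).add (hΦΨ.const_mul _)) ?_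
  filter_upwards [ae_ne_zero_extBall hR] with x hx
  have h := gradSq_add_le hx hε (Ψ x) (Φ x - Ψ x)
  rwa [add_sub_cancel] at h

end GradSq

section CompactSupport
variable {N : ℕ} {φ : E N → ℝ} {R : ℝ}

lemma exists_vanishing_radius (hs : HasCompactSupport φ) :
    ∃ K : ℝ, 0 ≤ K ∧ ∀ x, K ≤ ‖x‖ → φ x = 0 ∧ gradient φ x = 0 := by
  obtain ⟨K, hK⟩ := hs.isCompact.isBounded.subset_ball (0 : E N)
  refine ⟨max K 0, le_max_right .., fun x hx => ?_⟩
  have hmem : x ∉ tsupport φ := fun h =>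
    ((mem_ball_zero_iff.1 (hK h)).trans_le (le_max_left K 0)).not_ge hx
  have hfderiv : fderiv ℝ φ x = 0 :=
    Function.notMem_support.1 fun h => hmem (support_fderiv_subset ℝ h)
  exact ⟨image_eq_zero_of_notMem_tsupport hmem, by rw [gradient, hfderiv, map_zero]⟩

lemma continuous_gradient (hφ : ContDiff ℝ 1 φ) : Continuous (gradient φ) :=
  (InnerProductSpace.toDual ℝ (E N)).symm.continuous.comp (hφ.continuous_fderiv one_ne_zero)

lemma continuousOn_gradSq_gradient (hφ : ContDiff ℝ 1 φ) :
    ContinuousOn (fun x => gradSq x (gradient φ x)) {0}ᶜ := by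
  have hgrad := continuous_gradient hφ
  have hnorm_ne : ∀ x ∈ ({0}ᶜ : Set (E N)), ‖x‖ ≠ 0 := fun x hx => norm_ne_zero_iff.2 hx
  have hsinh_ne : ∀ x ∈ ({0}ᶜ : Set (E N)), Real.sinh ‖x‖ ≠ 0 := fun x hx =>
    (Real.sinh_pos_iff.2 (norm_pos_iff.2 hx)).ne'
  refine ContinuousOn.congr ?_ fun x hx => gradSq_eq hx _
  fun_prop (disch := assumption)

lemma integrableOn_gradSq_gradient (hφ : ContDiff ℝ 1 φ) (hs : HasCompactSupport φ)
    (hR : 0 < R) : IntegrableOn (fun x => gradSq x (gradient φ x)) (extBall N R) (hypVol N) := by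
  obtain ⟨K, -, hK⟩ := exists_vanishing_radius hs
  refine integrableOn_extBall_of_continuousOn hR (continuousOn_gradSq_gradient hφ) (K := K)
    fun x hx => ?_
  rw [(hK x hx).2, gradSq_zero]

lemma memLp_two_extBall_of_continuousOn (hφ : ContinuousOn φ {0}ᶜ) {K : ℝ}
    (hK : ∀ x, K ≤ ‖x‖ → φ x = 0) (hR : 0 < R) :
    MemLp φ 2 ((hypVol N).restrict (extBall N R)) := by
  have hmeas : AEStronglyMeasurable φ ((hypVol N).restrict (extBall N R)) :=
    (hφ.mono fun _ hx => ne_zero_of_mem_extBall hR.le hx).aestronglyMeasurable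
      (measurableSet_extBall N R)
  exact (memLp_two_iff_integrable_sq hmeas).2 <|
    integrableOn_extBall_of_continuousOn hR (hφ.pow 2) fun x hx => by
      rw [hK x hx, zero_pow two_ne_zero]

end CompactSupport

section InnerProductSpace
variable {H : Type*} [NormedAddCommGroup H] [InnerProductSpace ℝ H] {K L : Submodule ℝ H}
  [K.HasOrthogonalProjection] [L.HasOrthogonalProjection]

lemma norm_sq_starProjection_orthogonal (x : H) :
    ‖Kᗮ.starProjection x‖ ^ 2 = ‖x‖ ^ 2 - ‖K.starProjection x‖ ^ 2 := by
  rw [Submodule.norm_sq_eq_add_norm_sq_starProjection x K, add_sub_cancel_left]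

lemma norm_sq_starProjection_inf_orthogonal [(L ⊓ Kᗮ).HasOrthogonalProjection] (h : K ≤ L)
    (x : H) :
    ‖(L ⊓ Kᗮ).starProjection x‖ ^ 2 = ‖L.starProjection x‖ ^ 2 - ‖K.starProjection x‖ ^ 2 := by
  have hK : K.starProjection (L.starProjection x) = K.starProjection x :=
    DFunLike.congr_fun (Submodule.starProjection_comp_starProjection_of_le h) x
  have hmem : L.starProjection x - K.starProjection x ∈ L ⊓ Kᗮ := by
    refine Submodule.mem_inf.2 ⟨L.sub_mem (Submodule.starProjection_apply_mem ..)
      (h (Submodule.starProjection_apply_mem ..)), ?_⟩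
    rw [← hK]
    exact Submodule.sub_starProjection_mem_orthogonal _
  have horth : x - (L.starProjection x - K.starProjection x) ∈ (L ⊓ Kᗮ)ᗮ := by
    rw [← sub_add]
    exact Submodule.add_mem _
      (Submodule.orthogonal_le inf_le_left (Submodule.sub_starProjection_mem_orthogonal _))
      (Submodule.orthogonal_le inf_le_right
        (Submodule.le_orthogonal_orthogonal K (Submodule.starProjection_apply_mem ..)))
  rw [Submodule.eq_starProjection_of_mem_orthogonal hmem horth, ← hK,
    ← norm_sq_starProjection_orthogonal, Submodule.starProjection_orthogonal_val]

lemma norm_sq_starProjection_eq_sum {ι : Type*} [Fintype ι] (b : OrthonormalBasis ι ℝ K) (x : H) :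
    ‖K.starProjection x‖ ^ 2 = ∑ i, ⟪(b i : H), x⟫_ℝ ^ 2 := by
  rw [Submodule.starProjection_apply, ← Submodule.coe_norm, ← b.sum_sq_inner_right]
  simp only [Submodule.inner_orthogonalProjectionOnto_eq_of_mem_left]

end InnerProductSpace

section Energy
variable {N : ℕ}

/-- The span in `L²(𝕊^{N-1})` of the spherical harmonics of degrees `1, …, m`. -/
noncomputable def lowHarmonics (N m : ℕ) : Submodule ℝ (Lp ℝ 2 (sphMeas N)) :=
  polyL2 N m ⊓ (polyL2 N 0)ᗮ

instance finiteDimensional_lowHarmonics (m : ℕ) : FiniteDimensional ℝ (lowHarmonics N m) :=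
  Submodule.finiteDimensional_of_le inf_le_left

variable {φ : E N → ℝ}

lemma sphEig_mul_slice_le_sphDirichlet (hN : 2 ≤ N) (m : ℕ) (hφ : ContDiff ℝ 1 φ) (r : ℝ) :
    sphEig N (m + 1) * (‖(polyL2 N 0)ᗮ.starProjection (slice hφ r)‖ ^ 2
        - ‖(lowHarmonics N m).starProjection (slice hφ r)‖ ^ 2)
      ≤ sphDirichlet (fun x => φ (r • x)) (fun x => φ (r • x)) := by
  have hgap := sphEig_mul_le_sphDirichlet hN m (f := fun x => φ (r • x))
    (hφ.comp (contDiff_const_smul r)) (c := (polar hφ).curry r) fun θ => rfl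
  have hlow : ‖(lowHarmonics N m).starProjection (slice hφ r)‖ ^ 2
      = ‖(polyL2 N m).starProjection (slice hφ r)‖ ^ 2
        - ‖(polyL2 N 0).starProjection (slice hφ r)‖ ^ 2 :=
    norm_sq_starProjection_inf_orthogonal (polyL2_mono N m.zero_le) _
  rw [norm_sq_starProjection_orthogonal, hlow, sub_sub_sub_cancel_right]
  exact hgap

lemma integrableOn_sliceEnergy (hφ : ContDiff ℝ 1 φ) (hs : HasCompactSupport φ) {R : ℝ}
    (hR : 0 < R) (k : ℕ) :
    IntegrableOn (fun r => Real.sinh r ^ k * (‖sliceDeriv hφ r‖ ^ 2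
      + sphDirichlet (fun x => φ (r • x)) (fun x => φ (r • x)) / Real.sinh r ^ 2))
      (Set.Ioi R) := by
  obtain ⟨K, -, hK⟩ := exists_vanishing_radius hs
  have hsinh0 (r) (hr : r ∈ Set.Ici R) : Real.sinh r ^ 2 ≠ 0 :=
    pow_ne_zero _ (Real.sinh_pos_iff.2 (hR.trans_le hr)).ne'
  refine integrableOn_Ioi_of_continuousOn (K := max K R) ?_ fun r hr => ?_
  · have hsinh := Real.continuous_sinh.continuousOn (s := Set.Ici R)
    exact (hsinh.pow k).mul (((continuous_sliceDeriv hφ).norm.pow 2).continuousOn.add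
      ((continuous_sphDirichlet_comp_smul hφ).continuousOn.div (hsinh.pow 2) hsinh0))
  · have hr0 : 0 < r := hR.trans_le ((le_max_right _ _).trans hr)
    have hgradSq (θ : Sph N) : gradSq (r • (θ : E N)) (gradient φ (r • (θ : E N))) = 0 := by
      have hKr : K ≤ ‖r • (θ : E N)‖ :=
        ((le_max_left _ _).trans hr).trans_eq (norm_smul_sph hr0.le θ).symm
      rw [(hK _ hKr).2, gradSq_zero]
    simp only [← integral_gradSq_sph hφ hr0, hgradSq, integral_zero, mul_zero]

lemma integral_gradSq_gradient (hN : 1 ≤ N) (hφ : ContDiff ℝ 1 φ) (hs : HasCompactSupport φ)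
    {R : ℝ} (hR : 0 < R) :
    ∫ x in extBall N R, gradSq x (gradient φ x) ∂(hypVol N)
      = ∫ r in Set.Ioi R, Real.sinh r ^ (N - 1) * (‖sliceDeriv hφ r‖ ^ 2
        + sphDirichlet (fun x => φ (r • x)) (fun x => φ (r • x)) / Real.sinh r ^ 2) := by
  rw [setIntegral_extBall_eq_integral_Ioi hN hR.le (integrableOn_gradSq_gradient hφ hs hR)]
  exact setIntegral_congr_fun measurableSet_Ioi fun r hr => by
    simp only [integral_gradSq_sph hφ (hR.trans hr)]

lemma integrand_energy_le (hN : 2 ≤ N) {m : ℕ} {a : ℝ}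
    (ha : a * (a - (N - 2)) ≤ sphEig N (m + 1)) (hφ : ContDiff ℝ 1 φ) {R r : ℝ} (hR : 0 < R)
    (hr : R ≤ r) :
    Real.sinh r ^ (N - 1) * (‖(polyL2 N 0)ᗮ.starProjection (sliceDeriv hφ r)‖ ^ 2
        + a * (a - (N - 2)) / Real.sinh r ^ 2 * ‖(polyL2 N 0)ᗮ.starProjection (slice hφ r)‖ ^ 2)
      ≤ Real.sinh r ^ (N - 1) * (‖sliceDeriv hφ r‖ ^ 2
          + sphDirichlet (fun x => φ (r • x)) (fun x => φ (r • x)) / Real.sinh r ^ 2)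
        + sphEig N (m + 1) / Real.sinh R ^ 2
          * (Real.sinh r ^ (N - 1) * ‖(lowHarmonics N m).starProjection (slice hφ r)‖ ^ 2) := by
  have hs : 0 < Real.sinh r := Real.sinh_pos_iff.2 (hR.trans_le hr)
  have hμ : 0 ≤ sphEig N (m + 1) := by
    simpa [sphEig] using sphEig_mono hN (m + 1).zero_le
  have hradial : ‖(polyL2 N 0)ᗮ.starProjection (sliceDeriv hφ r)‖ ^ 2 ≤ ‖sliceDeriv hφ r‖ ^ 2 :=
    pow_le_pow_left₀ (norm_nonneg _) (Submodule.norm_starProjection_apply_le _ _) 2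
  have hangular : a * (a - (N - 2)) / Real.sinh r ^ 2
        * ‖(polyL2 N 0)ᗮ.starProjection (slice hφ r)‖ ^ 2
      ≤ sphDirichlet (fun x => φ (r • x)) (fun x => φ (r • x)) / Real.sinh r ^ 2
        + sphEig N (m + 1) / Real.sinh r ^ 2
          * ‖(lowHarmonics N m).starProjection (slice hφ r)‖ ^ 2 := by
    rw [div_mul_eq_mul_div, div_mul_eq_mul_div, ← add_div]
    gcongr
    linarith [sphEig_mul_slice_le_sphDirichlet hN m hφ r,
      mul_le_mul_of_nonneg_right ha (sq_nonneg ‖(polyL2 N 0)ᗮ.starProjection (slice hφ r)‖)]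
  calc _ ≤ Real.sinh r ^ (N - 1) * (‖sliceDeriv hφ r‖ ^ 2
          + (sphDirichlet (fun x => φ (r • x)) (fun x => φ (r • x)) / Real.sinh r ^ 2
          + sphEig N (m + 1) / Real.sinh r ^ 2
            * ‖(lowHarmonics N m).starProjection (slice hφ r)‖ ^ 2)) := by gcongr
    _ ≤ Real.sinh r ^ (N - 1) * (‖sliceDeriv hφ r‖ ^ 2
          + (sphDirichlet (fun x => φ (r • x)) (fun x => φ (r • x)) / Real.sinh r ^ 2
          + sphEig N (m + 1) / Real.sinh R ^ 2
            * ‖(lowHarmonics N m).starProjection (slice hφ r)‖ ^ 2)) := by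
      have := Real.sinh_le_sinh.2 hr
      gcongr
    _ = _ := by ring

lemma sinh_pow_mul_norm_sq_slice_le (hN : 2 ≤ N) {m : ℕ} {a : ℝ} (ha : 0 ≤ a)
    (hgap : a * (a - (N - 2)) ≤ sphEig N (m + 1)) (hφ : ContDiff ℝ 1 φ) (hs : HasCompactSupport φ)
    {R : ℝ} (hR : 0 < R) :
    a * (1 / Real.sinh R * (Real.sinh R ^ (N - 1)
        * ‖(polyL2 N 0)ᗮ.starProjection (slice hφ R)‖ ^ 2))
      ≤ ∫ x in extBall N R, gradSq x (gradient φ x) ∂(hypVol N)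
        + sphEig N (m + 1) / Real.sinh R ^ 2 * ∫ r in Set.Ioi R,
          Real.sinh r ^ (N - 1) * ‖(lowHarmonics N m).starProjection (slice hφ r)‖ ^ 2 := by
  obtain ⟨K, hK0, hK⟩ := exists_vanishing_radius hs
  have hslice (r) (hr : K ≤ r) : slice hφ r = 0 :=
    slice_eq_zero hφ (fun x hx => (hK x hx).1) (hK0.trans hr) hr
  have := continuous_slice hφ
  have := continuous_sliceDeriv hφ
  have hlow_int : IntegrableOn (fun r => Real.sinh r ^ (N - 1)
      * ‖(lowHarmonics N m).starProjection (slice hφ r)‖ ^ 2) (Set.Ioi R) :=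
    integrableOn_Ioi_of_continuousOn (K := K) (by fun_prop) fun r hr => by simp [hslice r hr]
  have hQ (r : ℝ) : HasDerivAt (fun r => (polyL2 N 0)ᗮ.starProjection (slice hφ r))
      ((polyL2 N 0)ᗮ.starProjection (sliceDeriv hφ r)) r :=
    (polyL2 N 0)ᗮ.starProjection.hasFDerivAt.comp_hasDerivAt r (hasDerivAt_slice hφ r)
  have hQ_zero (r) (hr : K ≤ r) : (polyL2 N 0)ᗮ.starProjection (slice hφ r) = 0 := by
    rw [hslice r hr, map_zero]
  have hN' : ((N - 2 : ℕ) : ℝ) = N - 2 := by push_cast [hN]; rfl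
  have hhardy := sinh_hardy (N - 2) ha hR hQ (by fun_prop) hQ_zero
  rw [hN', show N - 2 + 1 = N - 1 by omega] at hhardy
  rw [integral_gradSq_gradient (by omega) hφ hs hR, ← integral_const_mul,
    ← integral_add (integrableOn_sliceEnergy hφ hs hR _) (hlow_int.const_mul _)]
  calc _ = a * (Real.sinh R ^ (N - 2) * ‖(polyL2 N 0)ᗮ.starProjection (slice hφ R)‖ ^ 2) := by
        rw [show N - 1 = N - 2 + 1 by omega]
        have := (Real.sinh_pos_iff.2 hR).ne'
        field_simp
        ring
    _ ≤ _ := hhardy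
    _ ≤ _ := setIntegral_mono_on (integrableOn_sinh_pow_mul _ _ hR hQ (by fun_prop) hQ_zero)
        ((integrableOn_sliceEnergy hφ hs hR _).add (hlow_int.const_mul _)) measurableSet_Ioi
        fun r hr => integrand_energy_le hN hgap hφ hR (le_of_lt hr)

end Energy

section SeparatedFunctions
open MvPolynomial
variable {N : ℕ} {R K : ℝ} {c : ℝ → ℝ} {p : MvPolynomial (Fin N) ℝ}

/-- The function `c(r) p(θ)` in polar coordinates, for a radial profile `c` and a polynomial `p`
restricted to the sphere. -/
noncomputable def sepFun (c : ℝ → ℝ) (p : MvPolynomial (Fin N) ℝ) (x : E N) : ℝ :=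
  c ‖x‖ * polyFun N p (‖x‖⁻¹ • x)

lemma sepFun_smul {r : ℝ} (hr : 0 < r) (θ : Sph N) :
    sepFun c p (r • (θ : E N)) = c r * polyFun N p θ := by
  rw [sepFun, norm_smul_sph hr.le, inv_smul_smul₀ hr.ne']

lemma sepFun_eq_zero (hK : ∀ r, K ≤ r → c r = 0) (x : E N) (hx : K ≤ ‖x‖) : sepFun c p x = 0 := by
  rw [sepFun, hK _ hx, zero_mul]

lemma continuousOn_sepFun (hc : Continuous c) : ContinuousOn (sepFun c p) {0}ᶜ :=
  (hc.comp continuous_norm).continuousOn.mul <| (polyFun N p).continuous.comp_continuousOn <|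
    (continuous_norm.continuousOn.inv₀ fun _ hx => norm_ne_zero_iff.2 hx).smul continuousOn_id

lemma integral_sepFun_mul (hN : 1 ≤ N) (hR : 0 < R) (hc : Continuous c)
    (hK : ∀ r, K ≤ r → c r = 0) {φ : E N → ℝ} (hφ : ContDiff ℝ 1 φ) :
    ∫ x in extBall N R, sepFun c p x * φ x ∂(hypVol N)
      = ∫ r in Set.Ioi R, Real.sinh r ^ (N - 1) * (c r * ⟪polyClass N p, slice hφ r⟫_ℝ) := by
  have hint : IntegrableOn (fun x => sepFun c p x * φ x) (extBall N R) (hypVol N) :=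
    integrableOn_extBall_of_continuousOn hR ((continuousOn_sepFun hc).mul
      hφ.continuous.continuousOn) fun x hx => by rw [sepFun_eq_zero hK x hx, zero_mul]
  rw [setIntegral_extBall_eq_integral_Ioi hN hR.le hint]
  refine setIntegral_congr_fun measurableSet_Ioi fun r hr => ?_
  simp only [sepFun_smul (hR.trans hr), mul_assoc, integral_const_mul, polyClass_apply, slice,
    inner_toL2]
  rfl

lemma integral_sepFun_sq (hN : 1 ≤ N) (hR : 0 < R) (hc : Continuous c)
    (hK : ∀ r, K ≤ r → c r = 0) :
    ∫ x in extBall N R, sepFun c p x ^ 2 ∂(hypVol N)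
      = ∫ r in Set.Ioi R, Real.sinh r ^ (N - 1) * (c r ^ 2 * ‖polyClass N p‖ ^ 2) := by
  have hint : IntegrableOn (fun x => sepFun c p x ^ 2) (extBall N R) (hypVol N) :=
    integrableOn_extBall_of_continuousOn hR ((continuousOn_sepFun hc).pow 2)
      fun x hx => by rw [sepFun_eq_zero hK x hx, zero_pow two_ne_zero]
  rw [setIntegral_extBall_eq_integral_Ioi hN hR.le hint]
  refine setIntegral_congr_fun measurableSet_Ioi fun r hr => ?_
  simp only [sepFun_smul (hR.trans hr), mul_pow, integral_const_mul, polyClass_apply,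
    norm_toL2_sq, polySph_apply]

lemma integral_sepFun_mul_eq_zero {G : Subgroup (E N ≃ₗᵢ[ℝ] E N)} {m : ℕ}
    (hG : ∀ i, 1 ≤ i → i ≤ m → symEigenspace G (sphEig N i) = ⊥)
    (hR : 0 < R) (hc : Continuous c) (hK : ∀ r, K ≤ r → c r = 0)
    (hp : p ∈ restrictTotalDegree (Fin N) ℝ m) (horth : polyClass N p ∈ (polyL2 N 0)ᗮ)
    {ψ : E N → ℝ} (hψ : MemLp ψ 2 ((hypVol N).restrict (extBall N R)))
    (hsym : IsSymmetric G R ψ) :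
    ∫ x in extBall N R, sepFun c p x * ψ x ∂(hypVol N) = 0 := by
  have hcL2 : MemLp (fun x : E N => c ‖x‖) 2 ((hypVol N).restrict (extBall N R)) :=
    memLp_two_extBall_of_continuousOn (by fun_prop) (fun x hx => hK _ hx) hR
  have hzero := integral_mul_polyFun_dir_eq_zero hG
    (fun g _ => measurePreserving_hypVol_restrict R g) (ae_ne_zero_extBall hR.le)
    (hcL2.integrable_mul hψ) (fun g hg => ?_) hp horth
  · rw [← hzero]
    exact integral_congr_ae (Eventually.of_forall fun x => mul_right_comm _ _ _)
  · filter_upwards [hsym g hg] with x hx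
    rw [Pi.mul_apply, Pi.mul_apply, g.norm_map, hx]

lemma integral_sq_inner_slice_le (hN : 1 ≤ N) {G : Subgroup (E N ≃ₗᵢ[ℝ] E N)} {m : ℕ}
    (hG : ∀ i, 1 ≤ i → i ≤ m → symEigenspace G (sphEig N i) = ⊥)
    (hp : p ∈ restrictTotalDegree (Fin N) ℝ m) (horth : polyClass N p ∈ (polyL2 N 0)ᗮ)
    (hnorm : ‖polyClass N p‖ = 1) {φ : E N → ℝ} (hφ : ContDiff ℝ 1 φ)
    (hs : HasCompactSupport φ) (hR : 0 < R) {ψ : E N → ℝ}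
    (hψ : MemLp ψ 2 ((hypVol N).restrict (extBall N R))) (hsym : IsSymmetric G R ψ) :
    ∫ r in Set.Ioi R, Real.sinh r ^ (N - 1) * ⟪polyClass N p, slice hφ r⟫_ℝ ^ 2
      ≤ ∫ x in extBall N R, (φ x - ψ x) ^ 2 ∂(hypVol N) := by
  obtain ⟨K, hK0, hK⟩ := exists_vanishing_radius hs
  obtain ⟨c, hc⟩ : ∃ c : ℝ → ℝ, c = fun r => ⟪polyClass N p, slice hφ r⟫_ℝ := ⟨_, rfl⟩
  have hcont : Continuous c := hc ▸ continuous_const.inner (continuous_slice hφ)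
  have hcK (r) (hr : K ≤ r) : c r = 0 := by
    simp only [hc, slice_eq_zero hφ (fun x hx => (hK x hx).1) (hK0.trans hr) hr, inner_zero_right]
  have hφL2 := memLp_two_extBall_of_continuousOn hφ.continuous.continuousOn
    (fun x hx => (hK x hx).1) hR
  have hFL2 := memLp_two_extBall_of_continuousOn (continuousOn_sepFun (p := p) hcont)
    (sepFun_eq_zero hcK) hR
  have hFφ : IntegrableOn (fun x => sepFun c p x * φ x) (extBall N R) (hypVol N) :=
    hFL2.integrable_mul hφL2
  have hFψ : IntegrableOn (fun x => sepFun c p x * ψ x) (extBall N R) (hypVol N) :=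
    hFL2.integrable_mul hψ
  have hφψ : IntegrableOn (fun x => (φ x - ψ x) ^ 2) (extBall N R) (hypVol N) :=
    (hφL2.sub hψ).integrable_sq
  have hφ_eq := integral_sepFun_mul (p := p) hN hR hcont hcK hφ
  have hsq := integral_sepFun_sq (p := p) hN hR hcont hcK
  have hψ_zero := integral_sepFun_mul_eq_zero hG hR hcont hcK hp horth hψ hsym
  have hmono : ∫ x in extBall N R, 2 * (sepFun c p x * φ x - sepFun c p x * ψ x) ∂(hypVol N)
      ≤ ∫ x in extBall N R, (sepFun c p x ^ 2 + (φ x - ψ x) ^ 2) ∂(hypVol N) :=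
    integral_mono ((hFφ.sub hFψ).const_mul 2) (hFL2.integrable_sq.add hφψ) fun x => by
      linarith [two_mul_le_add_sq (sepFun c p x) (φ x - ψ x)]
  rw [integral_const_mul, integral_sub hFφ hFψ, integral_add hFL2.integrable_sq hφψ, hψ_zero,
    hφ_eq, hsq, hnorm] at hmono
  simp only [hc, one_pow, mul_one, ← sq] at hmono
  linarith

lemma integral_norm_sq_lowHarmonics_slice_le (hN : 1 ≤ N) {G : Subgroup (E N ≃ₗᵢ[ℝ] E N)} {m : ℕ}
    (hG : ∀ i, 1 ≤ i → i ≤ m → symEigenspace G (sphEig N i) = ⊥) {φ : E N → ℝ}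
    (hφ : ContDiff ℝ 1 φ) (hs : HasCompactSupport φ) (hR : 0 < R) {ψ : E N → ℝ}
    (hψ : MemLp ψ 2 ((hypVol N).restrict (extBall N R))) (hsym : IsSymmetric G R ψ) :
    ∫ r in Set.Ioi R, Real.sinh r ^ (N - 1) * ‖(lowHarmonics N m).starProjection (slice hφ r)‖ ^ 2
      ≤ Module.finrank ℝ (lowHarmonics N m)
        * ∫ x in extBall N R, (φ x - ψ x) ^ 2 ∂(hypVol N) := by
  obtain ⟨K, hK0, hK⟩ := exists_vanishing_radius hs
  let b := stdOrthonormalBasis ℝ (lowHarmonics N m)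
  have := continuous_slice hφ
  have hint (k) : IntegrableOn
      (fun r => Real.sinh r ^ (N - 1) * ⟪(b k : Lp ℝ 2 (sphMeas N)), slice hφ r⟫_ℝ ^ 2)
      (Set.Ioi R) :=
    integrableOn_Ioi_of_continuousOn (K := K) (by fun_prop) fun r hr => by
      rw [slice_eq_zero hφ (fun x hx => (hK x hx).1) (hK0.trans hr) hr, inner_zero_right,
        zero_pow two_ne_zero, mul_zero]
  have hcoef (k) : ∫ r in Set.Ioi R, Real.sinh r ^ (N - 1)
      * ⟪(b k : Lp ℝ 2 (sphMeas N)), slice hφ r⟫_ℝ ^ 2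
      ≤ ∫ x in extBall N R, (φ x - ψ x) ^ 2 ∂(hypVol N) := by
    obtain ⟨⟨p, hp, hpb⟩, horth⟩ := Submodule.mem_inf.1 (b k).2
    have hnorm : ‖(b k : Lp ℝ 2 (sphMeas N))‖ = 1 := b.norm_eq_one k
    rw [← hpb] at horth hnorm ⊢
    exact integral_sq_inner_slice_le hN hG hp horth hnorm hφ hs hR hψ hsym
  simp_rw [norm_sq_starProjection_eq_sum b, Finset.mul_sum]
  rw [integral_finsetSum _ fun k _ => hint k]
  simpa using Finset.sum_le_sum fun k (_ : k ∈ Finset.univ) => hcoef k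

end SeparatedFunctions

lemma norm_sq_eq_integral_sq {α : Type*} [MeasurableSpace α] {μ : Measure α} (f : Lp ℝ 2 μ) :
    ‖f‖ ^ 2 = ∫ x, f x ^ 2 ∂μ := by
  rw [← real_inner_self_eq_norm_sq, L2.inner_def]
  simp_rw [real_inner_self_eq_norm_sq, Real.norm_eq_abs, sq_abs]

section Trace
open MvPolynomial
variable {N : ℕ} {R : ℝ} {t : Sph N → ℝ}

lemma integral_bdryMeas (hR : 0 ≤ R) (f : Sph N → ℝ) :
    ∫ θ, f θ ∂(bdryMeas N R) = Real.sinh R ^ (N - 1) * ∫ θ, f θ ∂(sphMeas N) := by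
  rw [bdryMeas, integral_smul_measure, ENNReal.toReal_ofReal
    (pow_nonneg (Real.sinh_nonneg_iff.2 hR) _), smul_eq_mul]

lemma memLp_sphMeas_of_bdryMeas (hR : 0 < R) (ht : MemLp t 2 (bdryMeas N R)) :
    MemLp t 2 (sphMeas N) := by
  have hs : ENNReal.ofReal (Real.sinh R ^ (N - 1)) ≠ 0 := by
    simpa using pow_pos (Real.sinh_pos_iff.2 hR) _
  refine ht.of_measure_le_smul (ENNReal.inv_ne_top.2 hs) (le_of_eq ?_)
  rw [bdryMeas, smul_smul, ENNReal.inv_mul_cancel hs ENNReal.ofReal_ne_top, one_smul]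

lemma toLp_mem_orthogonal_polyL2_zero (ht : MemLp t 2 (sphMeas N))
    (hmean : ∫ θ, t θ ∂(sphMeas N) = 0) : ht.toLp t ∈ (polyL2 N 0)ᗮ := by
  rw [Submodule.mem_orthogonal]
  rintro _ ⟨p, hp, rfl⟩
  have hp0 : p = C (coeff 0 p) :=
    totalDegree_eq_zero_iff_eq_C.1 (Nat.le_zero.1 ((mem_restrictTotalDegree ..).1 hp))
  have hconst (θ : Sph N) : polySph N p θ = coeff 0 p := by
    rw [hp0, ← algebraMap_eq, AlgHom.commutes, algebraMap_eq, coeff_zero_C]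
    rfl
  have hae : (fun θ => ⟪polyClass N p θ, ht.toLp t θ⟫_ℝ) =ᵐ[sphMeas N]
      fun θ => coeff 0 p * t θ := by
    filter_upwards [ht.coeFn_toLp, coeFn_toL2 (polySph N p)] with θ htθ hpθ
    rw [polyClass_apply, hpθ, htθ, hconst, Real.inner_apply]
  rw [L2.inner_def, integral_congr_ae hae, integral_const_mul, hmean, mul_zero]

lemma norm_sq_slice_sub_toLp {φ : E N → ℝ} (hφ : ContDiff ℝ 1 φ) (ht : MemLp t 2 (sphMeas N)) :
    ‖slice hφ R - ht.toLp t‖ ^ 2 = ∫ θ : Sph N, (φ (R • (θ : E N)) - t θ) ^ 2 ∂(sphMeas N) := by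
  rw [norm_sq_eq_integral_sq]
  refine integral_congr_ae ?_
  filter_upwards [Lp.coeFn_sub (slice hφ R) (ht.toLp t), ht.coeFn_toLp,
    coeFn_toL2 ((polar hφ).curry R)] with θ hsub htθ hφθ
  rw [hsub, Pi.sub_apply, htθ, slice, hφθ]
  rfl

lemma tendsto_slice (hR : 0 < R) {φ : ℕ → E N → ℝ} (hφ : ∀ j, ContDiff ℝ 1 (φ j))
    (ht : MemLp t 2 (sphMeas N))
    (hlim : Tendsto (fun j => ∫ θ : Sph N, (φ j (R • (θ : E N)) - t θ) ^ 2 ∂(bdryMeas N R))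
      atTop (𝓝 0)) :
    Tendsto (fun j => slice (hφ j) R) atTop (𝓝 (ht.toLp t)) := by
  have hs : Real.sinh R ^ (N - 1) ≠ 0 := pow_ne_zero _ (Real.sinh_pos_iff.2 hR).ne'
  simp_rw [integral_bdryMeas hR.le, ← norm_sq_slice_sub_toLp (hφ _) ht] at hlim
  have hsq := hlim.const_mul (Real.sinh R ^ (N - 1))⁻¹
  simp only [inv_mul_cancel_left₀ hs, mul_zero] at hsq
  rw [tendsto_iff_norm_sub_tendsto_zero]
  simpa using hsq.sqrt

lemma tendsto_norm_sq_slice (hR : 0 < R) {φ : ℕ → E N → ℝ} (hφ : ∀ j, ContDiff ℝ 1 (φ j))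
    (ht : MemLp t 2 (bdryMeas N R)) (hmean : ∫ θ, t θ ∂(bdryMeas N R) = 0)
    (hlim : Tendsto (fun j => ∫ θ : Sph N, (φ j (R • (θ : E N)) - t θ) ^ 2 ∂(bdryMeas N R))
      atTop (𝓝 0)) :
    Tendsto (fun j => Real.sinh R ^ (N - 1)
        * ‖(polyL2 N 0)ᗮ.starProjection (slice (hφ j) R)‖ ^ 2)
      atTop (𝓝 (∫ θ, t θ ^ 2 ∂(bdryMeas N R))) := by
  have hs : Real.sinh R ^ (N - 1) ≠ 0 := pow_ne_zero _ (Real.sinh_pos_iff.2 hR).ne'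
  replace ht := memLp_sphMeas_of_bdryMeas hR ht
  rw [integral_bdryMeas hR.le, mul_eq_zero_iff_left hs] at hmean
  have hproj : (polyL2 N 0)ᗮ.starProjection (ht.toLp t) = ht.toLp t :=
    Submodule.starProjection_eq_self_iff.2 (toLp_mem_orthogonal_polyL2_zero ht hmean)
  have hnorm : ‖ht.toLp t‖ ^ 2 = ∫ θ, t θ ^ 2 ∂(sphMeas N) := by
    rw [norm_sq_eq_integral_sq]
    exact integral_congr_ae (ht.coeFn_toLp.pow_const 2)
  have hQ := ((polyL2 N 0)ᗮ.starProjection.continuous.tendsto _).comp (tendsto_slice hR hφ ht hlim)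
  rw [hproj] at hQ
  rw [integral_bdryMeas hR.le, ← hnorm]
  exact (hQ.norm.pow 2).const_mul _

end Trace

lemma le_of_tendsto_of_le_one_add_mul {c δ : ℕ → ℝ} {C D κ : ℝ} (hc : Tendsto c atTop (𝓝 C))
    (hδ : Tendsto δ atTop (𝓝 0))
    (h : ∀ ε > 0, ∀ j, c j ≤ (1 + ε) * D + (1 + 1 / ε + κ) * δ j) : C ≤ D := by
  have hε : ∀ ε > 0, C ≤ (1 + ε) * D := fun ε hε => by
    have hlim := (hδ.const_mul (1 + 1 / ε + κ)).const_add ((1 + ε) * D)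
    rw [mul_zero, add_zero] at hlim
    exact le_of_tendsto_of_tendsto' hc hlim (h ε hε)
  have hlim : Tendsto (fun ε : ℝ => (1 + ε) * D) (𝓝[>] 0) (𝓝 D) := by
    have hcont : Continuous fun ε : ℝ => (1 + ε) * D := by fun_prop
    simpa using (hcont.tendsto 0).mono_left nhdsWithin_le_nhds
  exact ge_of_tendsto hlim (eventually_nhdsWithin_of_forall hε)

section Main
variable {N m : ℕ} {R a : ℝ} {G : Subgroup (E N ≃ₗᵢ[ℝ] E N)} {ψ : E N → ℝ} {Ψ : E N → E N}
  {t : Sph N → ℝ}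

lemma sinh_pow_mul_norm_sq_slice_le_of_approx (hN : 2 ≤ N)
    (hG : ∀ i, 1 ≤ i → i ≤ m → symEigenspace G (sphEig N i) = ⊥) (ha : 0 ≤ a)
    (hgap : a * (a - (N - 2)) ≤ sphEig N (m + 1)) (hR : 0 < R) (hψ : MemH1 R ψ Ψ)
    (hsym : IsSymmetric G R ψ) {φ : E N → ℝ} (hφ : ContDiff ℝ 1 φ) (hs : HasCompactSupport φ)
    {ε : ℝ} (hε : 0 < ε) :
    a * (1 / Real.sinh R * (Real.sinh R ^ (N - 1)
        * ‖(polyL2 N 0)ᗮ.starProjection (slice hφ R)‖ ^ 2))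
      ≤ (1 + ε) * ∫ x in extBall N R, gradSq x (Ψ x) ∂(hypVol N)
        + (1 + 1 / ε + sphEig N (m + 1) / Real.sinh R ^ 2 * Module.finrank ℝ (lowHarmonics N m))
          * ∫ x in extBall N R, ((φ x - ψ x) ^ 2 + gradSq x (gradient φ x - Ψ x)) ∂(hypVol N) := by
  obtain ⟨K, -, hK⟩ := exists_vanishing_radius hs
  have hdist : IntegrableOn (fun x => (φ x - ψ x) ^ 2) (extBall N R) (hypVol N) :=
    ((memLp_two_extBall_of_continuousOn hφ.continuous.continuousOn (fun x hx => (hK x hx).1)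
      hR).sub hψ.memLp).integrable_sq
  have hgrad := integrableOn_gradSq_gradient hφ hs hR
  have hgrad_dist := integrableOn_gradSq_sub hR.le (continuous_gradient hφ).aestronglyMeasurable
    hψ.aesm_grad hgrad hψ.integrable_grad
  have hμ : 0 ≤ sphEig N (m + 1) := by
    simpa [sphEig] using sphEig_mono hN (m + 1).zero_le
  have hdist_nonneg : 0 ≤ ∫ x in extBall N R, (φ x - ψ x) ^ 2 ∂(hypVol N) :=
    integral_nonneg fun x => sq_nonneg _
  have hgrad_nonneg : 0 ≤ ∫ x in extBall N R, gradSq x (gradient φ x - Ψ x) ∂(hypVol N) :=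
    integral_nonneg_of_ae ((ae_ne_zero_extBall hR.le).mono fun x hx => gradSq_nonneg hx _)
  have henergy := sinh_pow_mul_norm_sq_slice_le hN ha hgap hφ hs hR
  have happrox := integral_gradSq_le hR.le hgrad hψ.integrable_grad hgrad_dist hε
  have hlow := mul_le_mul_of_nonneg_left
    (integral_norm_sq_lowHarmonics_slice_le (by omega) hG hφ hs hR hψ.memLp hsym)
    (div_nonneg hμ (sq_nonneg (Real.sinh R)))
  rw [integral_add hdist hgrad_dist]
  have hcross₁ := mul_nonneg (by positivity : 0 ≤ 1 + 1 / ε) hdist_nonneg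
  have hcross₂ := mul_nonneg (by positivity : 0 ≤ sphEig N (m + 1) / Real.sinh R ^ 2
    * Module.finrank ℝ (lowHarmonics N m)) hgrad_nonneg
  linarith

theorem lemma3p3_general (hN : 2 ≤ N)
    (hG : ∀ i, 1 ≤ i → i ≤ m → symEigenspace G (sphEig N i) = ⊥) (ha : 0 < a)
    (hgap : a * (a - (N - 2)) ≤ sphEig N (m + 1)) (hR : 0 < R) (hψ : MemH1 R ψ Ψ)
    (hsym : IsSymmetric G R ψ) (ht : IsTrace R ψ Ψ t)
    (hmean : ∫ θ, t θ ∂(bdryMeas N R) = 0) :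
    1 / Real.sinh R * ∫ θ, t θ ^ 2 ∂(bdryMeas N R)
      ≤ a⁻¹ * ∫ x in extBall N R, gradSq x (Ψ x) ∂(hypVol N) := by
  obtain ⟨htL2, φ, hφ, hlim, hlim_bdry⟩ := ht
  have hφ1 (j) : ContDiff ℝ 1 (φ j) := (hφ j).1.of_le (by exact_mod_cast le_top)
  rw [← div_eq_inv_mul, le_div_iff₀' ha]
  exact le_of_tendsto_of_le_one_add_mul
    (((tendsto_norm_sq_slice hR hφ1 htL2 hmean hlim_bdry).const_mul _).const_mul a) hlim
    fun ε hε j => sinh_pow_mul_norm_sq_slice_le_of_approx hN hG ha.le hgap hR hψ hsym (hφ1 j)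
      (hφ j).2 hε

lemma G1.exists_gap (hN : 2 ≤ N) (hG : G1 G) :
    ∃ m : ℕ, (∀ i, 1 ≤ i → i ≤ m → symEigenspace G (sphEig N i) = ⊥) ∧
      4 * ((N : ℝ) - 1) / 3 * (4 * ((N : ℝ) - 1) / 3 - (N - 2)) ≤ sphEig N (m + 1) := by
  obtain ⟨i₁, ⟨⟨hi₁, -⟩, hleast⟩, -, hlt⟩ := hG
  obtain ⟨m, rfl⟩ := Nat.exists_eq_add_of_le' hi₁
  refine ⟨m, fun i hi him => ?_, ?_⟩
  · by_contra hne
    exact absurd (hleast ⟨hi, hne⟩) (by omega)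
  · have hN' : (2 : ℝ) ≤ N := by exact_mod_cast hN
    have hsqrt : √(((N : ℝ) - 2) ^ 2 + 16 / 9 * ((N : ℝ) + 2) * ((N : ℝ) - 1))
        < 2 * (m + 1 : ℕ) + N - 2 := by linarith
    rw [Real.sqrt_lt' (by push_cast; linarith)] at hsqrt
    rw [sphEig]
    linarith

end Main

end HypExt

theorem lemma3p3 (N : ℕ) (hN : 2 ≤ N)
    (p : ℝ) (hp : 1 < p) (hp' : 2 < N → p < ((N : ℝ) + 2) / ((N : ℝ) - 2))
    (R : ℝ) (hR : 0 < R)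
    (G : Subgroup (E N ≃ₗᵢ[ℝ] E N)) (hG : G1 G)
    (ψ : E N → ℝ) (Ψ : E N → E N) (t : Sph N → ℝ)
    (hψ : MemH1 R ψ Ψ) (hsym : IsSymmetric G R ψ) (ht : IsTrace R ψ Ψ t)
    (hmean : ∫ θ, t θ ∂(bdryMeas N R) = 0)
    (horth : ∫ x in extBall N R, ψ x * zR N p R x ∂(hypVol N) = 0) :
    1 / Real.sinh R * ∫ θ, t θ ^ 2 ∂(bdryMeas N R)
      ≤ 3 / (4 * ((N : ℝ) - 1)) * ∫ x in extBall N R, gradSq x (Ψ x) ∂(hypVol N) := by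
  have ha : 0 < 4 * ((N : ℝ) - 1) / 3 := by
    have : (2 : ℝ) ≤ N := by exact_mod_cast hN
    linarith
  obtain ⟨m, hGm, hgap⟩ := hG.exists_gap hN
  simpa only [inv_div] using lemma3p3_general hN hGm ha hgap hR hψ hsym ht hmean
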